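/- Let $\beta>0$ be an inverse temperature and consider an $n$-level system with Hamiltonian $H_S=\sum_{i=1}^n E_i|i\rangle\langle i|$ and two states (density matrices) $\rho,\sigma$ such that 1. $\sigma$ is block-diagonal in the energy eigenbasis, i.e. $\langle i|\sigma|j\rangle=0$ whenever $E_i\neq E_j$; 2. $\rho$ can be converted into $\sigma$ by thermal operations, exactly or to arbitrary accuracy: $\sigma$ lies in the closure of the set of states $\mathrm{tr}_B\big[U(\rho\otimes\tau_B)U^\dagger\big]$, where $\tau_B=e^{-\beta H_B}/\mathrm{tr}\,e^{-\beta H_B}$ is the Gibbs state of some finite-level Hamiltonian $H_B$ and $U$ is a unitary with $[U,H_S+H_B]=0$. Then $\rho$ can be converted into $\sigma$ using Coarse Operations without expending any work, whatever the Hamiltonian $H_A=\sum_{s=1}^{2}a_s|s\rangle\langle s|$ of the ancilla qubit. Here a Coarse Operations protocol is a finite sequence of the following operations on the system, together with a real random variable $W$, the work spent so far, initially $0$: * (at most once) append a two-level ancilla in the Gibbs state of its Hamiltonian $H_A$, and later discard it, at a moment when the total Hamiltonian has the form $H'+H_A$, where $H'$ is any Hamiltonian $\sum_iE'_i|i\rangle\langle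 i|$ of the system; this leaves the system with Hamiltonian $H'$; * Partial Level Thermalization: on a state $\sum_i\eta_i|i\rangle\langle i|$ diagonal in the energy eigenbasis, for a set $\mathcal P$ of levels and $\lambda\in[0,1]$, replace $\eta_i$ by $(1-\lambda)\eta_i+\lambda\frac{e^{-\beta E_i}}{\sum_{j\in\mathcal P}e^{-\beta E_j}}\sum_{j\in\mathcal P}\eta_j$ for $i\in\mathcal P$, leaving the other $\eta_i$ unchanged (conditionally on every value of $W$); * Level Transformation: on a diagonal state, change the energies $E_i$ to $E_i+h_i$ ($h_i\in\mathbb R$) while keeping the populations, whereby $W$ increases by $h_i$ if the occupied level is $i$; * apply a (possibly randomly chosen) energy-conserving unitary to the system. While the ancilla is present, Partial Level Thermalizations and Level Transformations act on the joint levels, and the unitaries act on the system alone and commute with the total Hamiltonian. Conversion without expending any work means: there is a sequence of such protocols, each starting from $(\rho,H_S)$ and ending with the Hamiltonian $H_S$, for which the final states converge to $\sigma$ and the total work $W$ satisfies $\mathbb E[W]\to0$, $\mathrm{Var}(W)\to0$ and $\mathbb P(|W|\ge\delta)\to0$ for every $\delta>0$. (Energy levels stay finite in each protocol but may tend to infinity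 along the sequence.) -/

import Mathlib

open scoped Kronecker ComplexOrder

noncomputable section

namespace CoarseThermo

/-! ### Finite-level systems, Gibbs states and thermal operations -/

section Basic

variable {ι κ : Type} [Fintype ι] [DecidableEq ι] [Fintype κ] [DecidableEq κ]

/-- A quantum state (density matrix) of a system with level set `ι`. -/
def IsDensity (ρ : Matrix ι ι ℂ) : Prop := ρ.PosSemidef ∧ ρ.trace = 1

/-- The Hamiltonian `∑ i, E i |i⟩⟨i|`. -/
def hamiltonian (E : ι → ℝ) : Matrix ι ι ℂ := Matrix.diagonal fun i => (E i : ℂ)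

/-- The state has no coherence between levels of different energy
(coherence inside a degenerate energy level is allowed). -/
def IsBlockDiagonal (E : ι → ℝ) (σ : Matrix ι ι ℂ) : Prop :=
  ∀ i j, E i ≠ E j → σ i j = 0

/-- The Gibbs state of the Hamiltonian with energies `E` at inverse temperature `β`. -/
def gibbs (β : ℝ) (E : ι → ℝ) : Matrix ι ι ℂ :=
  Matrix.diagonal fun i => ((Real.exp (-β * E i) / ∑ j, Real.exp (-β * E j) : ℝ) : ℂ)

/-- Partial trace over the second tensor factor. -/
def traceOut (M : Matrix (ι × κ) (ι × κ) ℂ) : Matrix ι ι ℂ :=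
  Matrix.of fun i j => ∑ s, M (i, s) (j, s)

/-- `σ` is the result of a thermal operation on `ρ`: append a finite bath in its Gibbs state,
apply a unitary commuting with the total Hamiltonian, discard the bath. -/
def ThermalOperation (β : ℝ) (E : ι → ℝ) (ρ σ : Matrix ι ι ℂ) : Prop :=
  ∃ (m : ℕ) (_ : 0 < m) (B : Fin m → ℝ) (U : Matrix (ι × Fin m) (ι × Fin m) ℂ),
    U ∈ Matrix.unitaryGroup (ι × Fin m) ℂ ∧
    Commute U (hamiltonian fun x : ι × Fin m => E x.1 + B x.2) ∧
    σ = traceOut (U * (ρ ⊗ₖ gibbs β B) * U.conjTranspose)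

/-- `ρ` can be converted into `σ` by thermal operations, exactly or to arbitrary accuracy. -/
def ThermallyConvertible (β : ℝ) (E : ι → ℝ) (ρ σ : Matrix ι ι ℂ) : Prop :=
  σ ∈ closure {σ' | ThermalOperation β E ρ σ'}

end Basic

/-! ### Systems together with the record of the work spent on them -/

/-- A finite-level system with energies `energy`, together with the random variable `W`
("work spent so far", a finitely supported classical record). The matrix `branch w` is the
unnormalised state of the system on the event `W = w`: its trace is the probability of `W = w`,
and the sum of all branches is the state of the system. -/
structure Config (ι : Type) where
  energy : ι → ℝ
  branch : ℝ →₀ Matrix ι ι ℂ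

namespace Config

variable {ι κ : Type} [Fintype ι] [DecidableEq ι] [Fintype κ] [DecidableEq κ]

/-- The system in state `ρ` with energies `E`, before any work has been spent. -/
def initial (E : ι → ℝ) (ρ : Matrix ι ι ℂ) : Config ι := ⟨E, Finsupp.single 0 ρ⟩

/-- The state of the system, whatever the value of the work record. -/
def state (C : Config ι) : Matrix ι ι ℂ := C.branch.sum fun _ A => A

/-- `𝔼[W]`. -/
def workMean (C : Config ι) : ℝ := C.branch.sum fun w A => w * A.trace.re

/-- `Var[W]`. -/
def workVar (C : Config ι) : ℝ := C.branch.sum fun w A => (w - C.workMean) ^ 2 * A.trace.re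

/-- `ℙ(δ ≤ |W|)`. -/
def workTail (C : Config ι) (δ : ℝ) : ℝ :=
  C.branch.sum fun w A => if δ ≤ |w| then A.trace.re else 0

/-- The system is diagonal in the energy eigenbasis `|i⟩`. -/
def IsDiag (C : Config ι) : Prop := ∀ w, (C.branch w).IsDiag

/-- Apply a (linear) map to the system without spending work; `E'` are the new energies. -/
def mapState (E' : κ → ℝ) (f : Matrix ι ι ℂ → Matrix κ κ ℂ) (C : Config ι) : Config κ :=
  ⟨E', C.branch.sum fun w A => Finsupp.single w (f A)⟩

/-- Level Transformation with parameters `h`: the energies become `E i + h i`, the populations do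
not change, and a system that occupies level `i` costs the work `h i`.
(Used for diagonal systems only.) -/
def levelTransform (h : ι → ℝ) (C : Config ι) : Config ι :=
  ⟨fun i => C.energy i + h i,
    C.branch.sum fun w A => ∑ i, Finsupp.single (w + h i) (Matrix.single i i (A i i))⟩

end Config

section CoarseOperations

variable {ι : Type} [Fintype ι] [DecidableEq ι]

/-- Partial Level Thermalization over the levels in `P` with parameter `lam`, as a map of
populations. -/
def pltMap (β : ℝ) (E : ι → ℝ) (P : Finset ι) (lam : ℝ) (η : ι → ℂ) (i : ι) : ℂ :=
  if i ∈ P then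
    (1 - lam) * η i +
      ((lam * Real.exp (-β * E i) / ∑ j ∈ P, Real.exp (-β * E j) : ℝ) : ℂ) * ∑ j ∈ P, η j
  else η i

/-- Partial Level Thermalization of a system. (Used for diagonal systems only.) -/
def Config.plt (β : ℝ) (P : Finset ι) (lam : ℝ) (C : Config ι) : Config ι :=
  C.mapState C.energy fun A => Matrix.diagonal (pltMap β C.energy P lam fun i => A i i)

/-- Apply the unitary `U k` with probability `p k`. -/
def Config.randomUnitary {K : ℕ} (p : Fin K → ℝ) (U : Fin K → Matrix ι ι ℂ) (C : Config ι) :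
    Config ι :=
  C.mapState C.energy fun A => ∑ k, (p k : ℂ) • (U k * A * (U k).conjTranspose)

/-- One elementary coarse operation on a fixed set of levels. The energy-conserving unitaries
(chosen at random, possibly deterministically) are taken from the class `𝒰`. -/
inductive CoarseStep (β : ℝ) (𝒰 : Set (Matrix ι ι ℂ)) : Config ι → Config ι → Prop
  | levelTransformation (C : Config ι) (h : ι → ℝ) (hC : C.IsDiag) :
      CoarseStep β 𝒰 C (C.levelTransform h)
  | partialLevelThermalization (C : Config ι) (P : Finset ι) (lam : ℝ)
      (h0 : 0 ≤ lam) (h1 : lam ≤ 1) (hC : C.IsDiag) :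
      CoarseStep β 𝒰 C (C.plt β P lam)
  | unitary (C : Config ι) (K : ℕ) (p : Fin K → ℝ) (U : Fin K → Matrix ι ι ℂ)
      (hp : ∀ k, 0 ≤ p k) (hp1 : ∑ k, p k = 1)
      (hU : ∀ k, U k ∈ Matrix.unitaryGroup ι ℂ) (hU' : ∀ k, U k ∈ 𝒰)
      (hH : ∀ k, Commute (U k) (hamiltonian C.energy)) :
      CoarseStep β 𝒰 C (C.randomUnitary p U)

/-- Append an ancilla qubit with level energies `a`, in its Gibbs state. -/
def Config.appendAncilla (β : ℝ) (a : Fin 2 → ℝ) (C : Config ι) : Config (ι × Fin 2) :=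
  C.mapState (fun x => C.energy x.1 + a x.2) fun A => A ⊗ₖ gibbs β a

/-- Discard the ancilla qubit; `E'` are the energies of the remaining system. -/
def Config.discardAncilla (E' : ι → ℝ) (C : Config (ι × Fin 2)) : Config ι :=
  C.mapState E' traceOut

/-- `D` is obtained from `C` by a finite sequence of Coarse Operations that uses one ancilla qubit
with level energies `a`. Operations on the system alone may precede and follow the use of the
ancilla. While the ancilla is present, level transformations and partial level thermalizations act
on the joint levels and unitaries act on the system only. The ancilla may be discarded when the
total Hamiltonian is again a sum of a system Hamiltonian and that of the ancilla. -/
def CoarselyReachable (β : ℝ) (a : Fin 2 → ℝ) (C D : Config ι) : Prop :=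
  ∃ (C₁ : Config ι) (C₂ : Config (ι × Fin 2)) (E' : ι → ℝ),
    Relation.ReflTransGen (CoarseStep β Set.univ) C C₁ ∧
    Relation.ReflTransGen (CoarseStep β {V | ∃ U : Matrix ι ι ℂ, V = U ⊗ₖ 1})
      (C₁.appendAncilla β a) C₂ ∧
    (∀ i s, C₂.energy (i, s) = E' i + a s) ∧
    Relation.ReflTransGen (CoarseStep β Set.univ) (C₂.discardAncilla E') D

/-- `ρ` can be converted into `σ` by Coarse Operations with the ancilla `a` at no work cost: there
is a sequence of finite protocols, each ending with the original Hamiltonian, such that the final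
states converge to `σ` and the distributions of the total work concentrate at `0`. -/
def FreelyCoarselyConvertible (β : ℝ) (a : Fin 2 → ℝ) (E : ι → ℝ) (ρ σ : Matrix ι ι ℂ) : Prop :=
  ∃ D : ℕ → Config ι,
    (∀ t, CoarselyReachable β a (Config.initial E ρ) (D t)) ∧
    (∀ t, (D t).energy = E) ∧
    Filter.Tendsto (fun t => (D t).state) Filter.atTop (nhds σ) ∧
    Filter.Tendsto (fun t => (D t).workMean) Filter.atTop (nhds 0) ∧
    Filter.Tendsto (fun t => (D t).workVar) Filter.atTop (nhds 0) ∧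
    ∀ δ : ℝ, 0 < δ → Filter.Tendsto (fun t => (D t).workTail δ) Filter.atTop (nhds 0)

end CoarseOperations

end CoarseThermo

end

set_option linter.unusedSectionVars false

open scoped Kronecker ComplexOrder

namespace CoarseThermo

open Relation

namespace Config

variable {ι κ : Type} [Fintype ι] [DecidableEq ι] [Fintype κ] [DecidableEq κ]

/-! ### Functionals of the work record -/

/-! The bridge between the two classes of operations is thermo-majorization. Let energy-conserving
unitaries `V`, `W` diagonalise `ρ` and `σ` inside every energy eigenspace, let `p`, `q` be the
resulting populations, and put `w i = exp (-β E i)`. A thermal operation maps `p` to `q` by a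
stochastic matrix that fixes `w`, so convexity gives `∑ max (q i - c w i) 0 ≤ ∑ max (p i - c w i) 0`
for all `c` (`ThermalOperation.sum_max_le`). This survives limits because it is a closed condition
on `σ`.

Conversely, random phases after `V` leave exactly the diagonal state `p`, and it remains to realise
`p → q`. Describe a level by the vector (population, Gibbs weight). A slow isothermal process on two
levels replaces vectors `u`, `v` by `θ (u + v)`, `(1 - θ) (u + v)`: each of its `N` steps raises the
second moment of `W` by `O(1/N²)`, so the total cost vanishes (`exists_isothermal`). In the limits
`θ = 0, 1` one level is lifted to infinite energy and becomes the zero vector. Levels can thus be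
split and merged, and partial thermalization moves population from a denser to a less dense level.

The ancilla provides the room for this. Merging the two copies of every system level leaves `n`
vectors proportional to the system's and `n` zero vectors. The spare vectors allow levels to be cut
along the Lorenz curve of `p` into blocks that have the weights of `q`'s levels in order of `q`'s
density (`exists_blocks`). Majorization says that the block populations dominate `q` in partial
sums, so finitely many downhill transfers produce `q` (`Flows.of_partialSum_le`). A spare vector
also allows any relabelling of the levels. Splitting every level again in the Gibbs ratio of the
ancilla restores the product form; the ancilla is discarded and the inverse of `W` is applied.

Limits are handled by `Attainable`: descriptions together with the value `0` for the second moment,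
in the closure of what protocols realise. Since `E[W²]` controls mean, variance and tails, no other
statistic of the work is followed. -/

theorem sum_mapState {M : Type*} [AddCommMonoid M] (E' : κ → ℝ)
    (f : Matrix ι ι ℂ → Matrix κ κ ℂ) (C : Config ι) (T : ℝ → Matrix κ κ ℂ →+ M) :
    ((C.mapState E' f).branch.sum fun w A => T w A) = C.branch.sum fun w A => T w (f A) := by
  unfold mapState
  rw [Finsupp.sum_sum_index (fun w => map_zero (T w)) (fun w A B => map_add (T w) A B)]
  exact Finsupp.sum_congr fun w _ => Finsupp.sum_single_index (map_zero (T w))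

/-- Different pairs of old work value and level may lead to the same new work value, where the
branches are added; hence the restriction to functionals additive in the branch. -/
theorem sum_levelTransform {M : Type*} [AddCommMonoid M] (h : ι → ℝ) (C : Config ι)
    (T : ℝ → Matrix ι ι ℂ →+ M) :
    ((C.levelTransform h).branch.sum fun w A => T w A) =
      C.branch.sum fun w A => ∑ i, T (w + h i) (Matrix.single i i (A i i)) := by
  unfold levelTransform
  rw [Finsupp.sum_sum_index (fun w => map_zero (T w)) (fun w A B => map_add (T w) A B)]
  refine Finsupp.sum_congr fun w _ => ?_
  rw [← Finsupp.sum_finsetSum_index (fun w => map_zero (T w)) (fun w A B => map_add (T w) A B)]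
  exact Finset.sum_congr rfl fun i _ => Finsupp.sum_single_index (map_zero (T _))

/-- The contribution of level `i` to the expectation of `g W`. -/
noncomputable def moment (g : ℝ → ℝ) (C : Config ι) (i : ι) : ℝ :=
  C.branch.sum fun w A => g w * (A i i).re

/-- The expectation of `g W`. -/
noncomputable def expect (g : ℝ → ℝ) (C : Config ι) : ℝ :=
  C.branch.sum fun w A => g w * A.trace.re

/-- The functional `A ↦ g w * Re (A i i)`. -/
noncomputable def entryHom (g : ℝ → ℝ) (i : ι) (w : ℝ) : Matrix ι ι ℂ →+ ℝ where
  toFun A := g w * (A i i).re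
  map_zero' := by simp
  map_add' A B := by simp [mul_add]

/-- The functional `A ↦ g w * Re (tr A)`. -/
noncomputable def traceHom (g : ℝ → ℝ) (w : ℝ) : Matrix ι ι ℂ →+ ℝ where
  toFun A := g w * A.trace.re
  map_zero' := by simp
  map_add' A B := by simp [mul_add]

theorem sum_moment (g : ℝ → ℝ) (C : Config ι) : ∑ i, C.moment g i = C.expect g := by
  unfold moment expect Finsupp.sum
  rw [Finset.sum_comm]
  refine Finset.sum_congr rfl fun w _ => ?_
  simp only [Matrix.trace, Matrix.diag_apply, Complex.re_sum, Finset.mul_sum]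

theorem moment_mapState (g : ℝ → ℝ) (E' : κ → ℝ) (f : Matrix ι ι ℂ → Matrix κ κ ℂ) (C : Config ι)
    (i : κ) : (C.mapState E' f).moment g i = C.branch.sum fun w A => g w * (f A i i).re :=
  sum_mapState E' f C (entryHom g i)

theorem expect_mapState (g : ℝ → ℝ) (E' : κ → ℝ) (f : Matrix ι ι ℂ → Matrix κ κ ℂ) (C : Config ι) :
    (C.mapState E' f).expect g = C.branch.sum fun w A => g w * (f A).trace.re :=
  sum_mapState E' f C (traceHom g)

theorem state_mapState (E' : κ → ℝ) (f : Matrix ι ι ℂ →+ Matrix κ κ ℂ) (C : Config ι) :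
    (C.mapState E' f).state = f C.state := by
  unfold state
  rw [map_finsuppSum]
  exact sum_mapState E' f C fun _ => AddMonoidHom.id _

theorem moment_add (f g : ℝ → ℝ) (C : Config ι) (i : ι) :
    C.moment (fun w => f w + g w) i = C.moment f i + C.moment g i := by
  simp only [moment, add_mul, Finsupp.sum_add]

theorem moment_const_mul (c : ℝ) (g : ℝ → ℝ) (C : Config ι) (i : ι) :
    C.moment (fun w => c * g w) i = c * C.moment g i := by
  simp only [moment, mul_assoc, Finsupp.mul_sum]

theorem moment_levelTransform (g : ℝ → ℝ) (h : ι → ℝ) (C : Config ι) (i : ι) :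
    (C.levelTransform h).moment g i = C.moment (fun w => g (w + h i)) i := by
  refine (sum_levelTransform h C (entryHom g i)).trans ?_
  refine Finsupp.sum_congr fun w _ => ?_
  rw [Finset.sum_eq_single i]
  · simp [entryHom]
  · intro j _ hj
    simp [entryHom, Matrix.single, hj]
  · simp

theorem moment_plt (g : ℝ → ℝ) (β : ℝ) (P : Finset ι) (lam : ℝ) (C : Config ι) (i : ι) :
    (C.plt β P lam).moment g i =
      if i ∈ P then (1 - lam) * C.moment g i +
        lam * Real.exp (-β * C.energy i) / (∑ j ∈ P, Real.exp (-β * C.energy j)) *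
          ∑ j ∈ P, C.moment g j
      else C.moment g i := by
  rw [plt, moment_mapState]
  simp only [Matrix.diagonal_apply_eq, pltMap]
  split_ifs with hi
  · have hre : ∀ a b : ℝ, ∀ x y : ℂ, (((1 : ℂ) - (a : ℂ)) * x + (b : ℂ) * y).re =
        (1 - a) * x.re + b * y.re := by
      intro a b x y
      simp
    simp only [hre, Complex.re_sum, mul_add, Finsupp.sum_add, moment]
    congr 1
    · rw [Finsupp.mul_sum]
      exact Finsupp.sum_congr fun w _ => by ring
    · unfold Finsupp.sum
      rw [Finset.sum_comm, Finset.mul_sum]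
      refine Finset.sum_congr rfl fun w _ => ?_
      rw [← Finset.mul_sum]
      ring
  · rfl

/-! ### Classical configurations -/

/-- Diagonal matrices with nonnegative entries. -/
def classicalMatrices (ι : Type) : AddSubmonoid (Matrix ι ι ℂ) where
  carrier := {A | A.IsDiag ∧ ∀ i, 0 ≤ A i i}
  add_mem' hA hB := ⟨hA.1.add hB.1, fun i => add_nonneg (hA.2 i) (hB.2 i)⟩
  zero_mem' := ⟨Matrix.isDiag_zero, fun _ => le_rfl⟩

/-- All branches are diagonal with nonnegative entries. -/
def IsClassical (C : Config ι) : Prop := ∀ w, C.branch w ∈ classicalMatrices ι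

theorem IsClassical.isDiag {C : Config ι} (hC : C.IsClassical) : C.IsDiag := fun w => (hC w).1

theorem single_apply_mem {M : Type*} [AddCommMonoid M] (S : AddSubmonoid M) {A : M} (hA : A ∈ S)
    (w w' : ℝ) : Finsupp.single w A w' ∈ S := by
  rw [Finsupp.single_apply]
  split_ifs
  · exact hA
  · exact S.zero_mem

theorem IsClassical.mapState {C : Config ι} (hC : C.IsClassical) (E' : κ → ℝ)
    {f : Matrix ι ι ℂ → Matrix κ κ ℂ}
    (hf : ∀ A ∈ classicalMatrices ι, f A ∈ classicalMatrices κ) :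
    (C.mapState E' f).IsClassical := by
  intro w
  rw [Config.mapState, Finsupp.sum_apply]
  exact AddSubmonoid.sum_mem _ fun w' _ => single_apply_mem _ (hf _ (hC w')) _ _

theorem IsClassical.levelTransform {C : Config ι} (hC : C.IsClassical) (h : ι → ℝ) :
    (C.levelTransform h).IsClassical := by
  intro w
  rw [Config.levelTransform, Finsupp.sum_apply]
  refine AddSubmonoid.sum_mem _ fun w' _ => ?_
  dsimp only
  rw [Finsupp.finsetSum_apply]
  refine AddSubmonoid.sum_mem _ fun i _ => single_apply_mem (classicalMatrices ι) ⟨?_, ?_⟩ _ _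
  · intro j k hjk
    rw [Matrix.single_apply, if_neg]
    rintro ⟨rfl, rfl⟩
    exact hjk rfl
  · intro j
    rw [Matrix.single_apply]
    split_ifs
    · exact (hC w').2 i
    · exact le_rfl

theorem IsClassical.plt {C : Config ι} (hC : C.IsClassical) (β : ℝ) (P : Finset ι) {lam : ℝ}
    (h0 : 0 ≤ lam) (h1 : lam ≤ 1) : (C.plt β P lam).IsClassical := by
  refine hC.mapState _ fun A hA => ⟨Matrix.isDiag_diagonal _, fun i => ?_⟩
  rw [Matrix.diagonal_apply_eq, pltMap]
  split_ifs
  · have h1' : (0 : ℂ) ≤ 1 - (lam : ℂ) := by exact_mod_cast sub_nonneg.2 h1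
    refine add_nonneg (mul_nonneg h1' (hA.2 i)) (mul_nonneg ?_ (Finset.sum_nonneg fun j _ => hA.2 j))
    exact_mod_cast div_nonneg (mul_nonneg h0 (Real.exp_pos _).le)
      (Finset.sum_nonneg fun j _ => (Real.exp_pos _).le)
  · exact hA.2 i

theorem IsClassical.moment_mono {C : Config ι} (hC : C.IsClassical) {f g : ℝ → ℝ}
    (hfg : ∀ w, f w ≤ g w) (i : ι) : C.moment f i ≤ C.moment g i :=
  Finset.sum_le_sum fun w _ =>
    mul_le_mul_of_nonneg_right (hfg w) (Complex.nonneg_iff.1 ((hC w).2 i)).1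

theorem IsClassical.moment_nonneg {C : Config ι} (hC : C.IsClassical) {g : ℝ → ℝ}
    (hg : ∀ w, 0 ≤ g w) (i : ι) : 0 ≤ C.moment g i :=
  Finset.sum_nonneg fun w _ => mul_nonneg (hg w) (Complex.nonneg_iff.1 ((hC w).2 i)).1

/-! ### Work statistics are controlled by the second moment -/

theorem workMean_eq_expect (C : Config ι) : C.workMean = C.expect fun w => w := rfl

/-- All branches have traces with nonnegative real part, and the total probability is one. -/
structure IsNormalized (C : Config ι) : Prop where
  nonneg : ∀ w, 0 ≤ (C.branch w).trace.re
  total : C.expect (fun _ => 1) = 1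

theorem expect_add (f g : ℝ → ℝ) (C : Config ι) :
    C.expect (fun w => f w + g w) = C.expect f + C.expect g := by
  simp only [expect, add_mul, Finsupp.sum_add]

theorem expect_const_mul (c : ℝ) (g : ℝ → ℝ) (C : Config ι) :
    C.expect (fun w => c * g w) = c * C.expect g := by
  simp only [expect, mul_assoc, Finsupp.mul_sum]

theorem IsNormalized.expect_sub_sq {C : Config ι} (hC : C.IsNormalized) (c : ℝ) :
    C.expect (fun w => (w - c) ^ 2) = C.expect (fun w => w ^ 2) - 2 * c * C.workMean + c ^ 2 := by
  have : (fun w : ℝ => (w - c) ^ 2) = fun w => w ^ 2 + ((-2 * c) * w + c ^ 2 * 1) := by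
    funext w
    ring
  rw [this, expect_add, expect_add, expect_const_mul (-2 * c) (fun w => w),
    expect_const_mul (c ^ 2) (fun _ => 1), hC.total, workMean_eq_expect]
  ring

theorem IsNormalized.workVar_eq {C : Config ι} (hC : C.IsNormalized) :
    C.workVar = C.expect (fun w => w ^ 2) - C.workMean ^ 2 := by
  have : C.workVar = C.expect fun w => (w - C.workMean) ^ 2 := rfl
  rw [this, hC.expect_sub_sq]
  ring

theorem IsNormalized.workVar_nonneg {C : Config ι} (hC : C.IsNormalized) : 0 ≤ C.workVar :=
  Finset.sum_nonneg fun w _ => mul_nonneg (sq_nonneg _) (hC.nonneg w)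

theorem IsNormalized.workTail_nonneg {C : Config ι} (hC : C.IsNormalized) (δ : ℝ) :
    0 ≤ C.workTail δ := by
  refine Finset.sum_nonneg fun w _ => ?_
  dsimp only
  split_ifs
  · exact hC.nonneg w
  · exact le_rfl

theorem IsNormalized.workTail_le {C : Config ι} (hC : C.IsNormalized) {δ : ℝ} (hδ : 0 < δ) :
    C.workTail δ ≤ C.expect (fun w => w ^ 2) / δ ^ 2 := by
  rw [div_eq_inv_mul, ← expect_const_mul]
  refine Finset.sum_le_sum fun w _ => ?_
  dsimp only
  have h0 := hC.nonneg w
  split_ifs with h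
  · refine le_mul_of_one_le_left h0 ?_
    rw [← div_eq_inv_mul, one_le_div (by positivity), ← sq_abs w]
    gcongr
  · positivity

-- The mean is bounded by the root of `E[W²]`, the variance by `E[W²]` itself, and the tail by
-- Chebyshev's inequality. This is why the protocols below keep track of the second moment only.
open Filter Topology in
theorem tendsto_work_of_expect_sq {D : ℕ → Config ι} (hD : ∀ t, (D t).IsNormalized)
    (h : Tendsto (fun t => (D t).expect fun w => w ^ 2) atTop (𝓝 0)) :
    Tendsto (fun t => (D t).workMean) atTop (𝓝 0) ∧
    Tendsto (fun t => (D t).workVar) atTop (𝓝 0) ∧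
    ∀ δ : ℝ, 0 < δ → Tendsto (fun t => (D t).workTail δ) atTop (𝓝 0) := by
  refine ⟨?_, ?_, fun δ hδ => ?_⟩
  · have hs : Tendsto (fun t => √((D t).expect fun w => w ^ 2)) atTop (𝓝 0) := by
      simpa using h.sqrt
    refine squeeze_zero_norm (fun t => Real.abs_le_sqrt ?_) hs
    linarith [(hD t).workVar_eq, (hD t).workVar_nonneg]
  · refine squeeze_zero (fun t => (hD t).workVar_nonneg) (fun t => ?_) h
    rw [(hD t).workVar_eq]
    linarith [sq_nonneg (D t).workMean]
  · refine squeeze_zero (fun t => (hD t).workTail_nonneg δ) (fun t => (hD t).workTail_le hδ) ?_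
    simpa using h.div_const (δ ^ 2)

end Config

end CoarseThermo

namespace CoarseThermo

open Relation

/-! ### Isothermal processes on a pair of levels -/

/-! ### Logarithmic estimates for two-point distributions -/

section LogBounds

/-- Apply `log t ≤ t - 1` to both `g / f` and `f / g`. The bound makes the energy shift in one
isothermal step of first order in the step length. -/
theorem abs_log_div_le {κ f g : ℝ} (hκ : 0 < κ) (hf : κ ≤ f) (hg : κ ≤ g) :
    |Real.log (g / f)| ≤ |g - f| / κ := by
  have key : ∀ a b : ℝ, κ ≤ a → κ ≤ b → Real.log (b / a) ≤ |b - a| / κ := by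
    intro a b ha hb
    have ha0 : 0 < a := hκ.trans_le ha
    have hb0 : 0 < b := hκ.trans_le hb
    calc Real.log (b / a) ≤ b / a - 1 := Real.log_le_sub_one_of_pos (by positivity)
      _ = (b - a) / a := by field_simp
      _ ≤ |b - a| / a := by gcongr; exact le_abs_self _
      _ ≤ |b - a| / κ := by gcongr
  rw [abs_le]
  constructor
  · have := key g f hg hf
    rw [abs_sub_comm, ← inv_div, Real.log_inv] at this
    linarith
  · exact key f g hf hg

/-- The relative entropy of nearby distributions on two points is quadratically small. -/
theorem abs_relEntropy_le {κ f g : ℝ} (hκ : 0 < κ) (hf : κ ≤ f) (hf' : f ≤ 1 - κ) (hg : κ ≤ g)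
    (hg' : g ≤ 1 - κ) :
    |f * Real.log (g / f) + (1 - f) * Real.log ((1 - g) / (1 - f))| ≤ (g - f) ^ 2 / κ ^ 2 := by
  have hf0 : 0 < f := hκ.trans_le hf
  have hg0 : 0 < g := hκ.trans_le hg
  have hf1 : 0 < 1 - f := by linarith
  have hg1 : 0 < 1 - g := by linarith
  rw [abs_le]
  constructor
  -- Bounding the logarithms of the inverse ratios turns the relative entropy into the χ² distance
  -- `(g - f)² / (g (1 - g))`. The opposite inequality below is Gibbs' inequality: the sum is at
  -- most zero.
  · have h1 : Real.log (f / g) ≤ f / g - 1 := Real.log_le_sub_one_of_pos (by positivity)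
    have h2 : Real.log ((1 - f) / (1 - g)) ≤ (1 - f) / (1 - g) - 1 :=
      Real.log_le_sub_one_of_pos (by positivity)
    rw [← inv_div, Real.log_inv, inv_div] at h1 h2
    have h3 : f * (f / g - 1) + (1 - f) * ((1 - f) / (1 - g) - 1) =
        (g - f) ^ 2 / (g * (1 - g)) := by
      field_simp
      ring
    have h4 : (g - f) ^ 2 / (g * (1 - g)) ≤ (g - f) ^ 2 / κ ^ 2 := by
      gcongr
      nlinarith
    nlinarith [mul_le_mul_of_nonneg_left h1 hf0.le, mul_le_mul_of_nonneg_left h2 hf1.le]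
  · have h1 : Real.log (g / f) ≤ g / f - 1 := Real.log_le_sub_one_of_pos (by positivity)
    have h2 : Real.log ((1 - g) / (1 - f)) ≤ (1 - g) / (1 - f) - 1 :=
      Real.log_le_sub_one_of_pos (by positivity)
    have h3 : f * (g / f - 1) + (1 - f) * ((1 - g) / (1 - f) - 1) = 0 := by
      field_simp
      ring
    have h4 : 0 ≤ (g - f) ^ 2 / κ ^ 2 := by positivity
    nlinarith [mul_le_mul_of_nonneg_left h1 hf0.le, mul_le_mul_of_nonneg_left h2 hf1.le]

end LogBounds

variable {ι : Type} [Fintype ι] [DecidableEq ι]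

namespace Config

/-- The Gibbs weight of a level. -/
noncomputable def weight (β : ℝ) (C : Config ι) (k : ι) : ℝ := Real.exp (-β * C.energy k)

/-- The population of a level. -/
noncomputable def population (C : Config ι) (k : ι) : ℝ := C.moment (fun _ => 1) k

/-- `𝔼[W²]`. -/
noncomputable def secondMoment (C : Config ι) : ℝ := C.expect fun w => w ^ 2

theorem weight_pos (β : ℝ) (C : Config ι) (k : ι) : 0 < C.weight β k := Real.exp_pos _

theorem weight_plt (β : ℝ) (P : Finset ι) (lam : ℝ) (C : Config ι) :
    (C.plt β P lam).weight β = C.weight β := rfl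

theorem weight_levelTransform (β : ℝ) (h : ι → ℝ) (C : Config ι) (k : ι) :
    (C.levelTransform h).weight β k = C.weight β k * Real.exp (-β * h k) := by
  simp only [weight, levelTransform, ← Real.exp_add, mul_add]

theorem moment_plt_pair_left (g : ℝ → ℝ) (β lam : ℝ) (C : Config ι) {i j : ι} (hij : i ≠ j) :
    (C.plt β {i, j} lam).moment g i = (1 - lam) * C.moment g i +
      lam * C.weight β i / (C.weight β i + C.weight β j) * (C.moment g i + C.moment g j) := by
  rw [moment_plt, if_pos (by simp), Finset.sum_pair hij, Finset.sum_pair hij]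
  rfl

theorem moment_plt_pair_right (g : ℝ → ℝ) (β lam : ℝ) (C : Config ι) {i j : ι} (hij : i ≠ j) :
    (C.plt β {i, j} lam).moment g j = (1 - lam) * C.moment g j +
      lam * C.weight β j / (C.weight β i + C.weight β j) * (C.moment g i + C.moment g j) := by
  rw [moment_plt, if_pos (by simp), Finset.sum_pair hij, Finset.sum_pair hij]
  rfl

theorem moment_plt_pair_of_ne (g : ℝ → ℝ) (β lam : ℝ) (C : Config ι) {i j k : ι} (hi : k ≠ i)
    (hj : k ≠ j) : (C.plt β {i, j} lam).moment g k = C.moment g k := by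
  rw [moment_plt, if_neg (by simp [hi, hj])]

theorem moment_plt_pair_add (g : ℝ → ℝ) (β lam : ℝ) (C : Config ι) {i j : ι} (hij : i ≠ j) :
    (C.plt β {i, j} lam).moment g i + (C.plt β {i, j} lam).moment g j =
      C.moment g i + C.moment g j := by
  rw [moment_plt_pair_left g β lam C hij, moment_plt_pair_right g β lam C hij]
  have hi := C.weight_pos β i
  have hj := C.weight_pos β j
  field_simp
  ring

theorem expect_plt_pair (g : ℝ → ℝ) (β lam : ℝ) (C : Config ι) {i j : ι} (hij : i ≠ j) :
    (C.plt β {i, j} lam).expect g = C.expect g := by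
  rw [← sum_moment, ← sum_moment, ← sub_eq_zero, ← Finset.sum_sub_distrib,
    Fintype.sum_eq_add i j hij]
  · linarith [moment_plt_pair_add g β lam C hij]
  · rintro k ⟨hi, hj⟩
    rw [moment_plt_pair_of_ne g β lam C hi hj, sub_self]

theorem moment_add_sq (C : Config ι) (c : ℝ) (k : ι) :
    C.moment (fun w => (w + c) ^ 2) k =
      C.moment (fun w => w ^ 2) k + 2 * c * C.moment (fun w => w) k + c ^ 2 * C.population k := by
  have : (fun w : ℝ => (w + c) ^ 2) = fun w => (w ^ 2 + (2 * c) * w) + c ^ 2 * 1 := by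
    funext w
    ring
  rw [this, moment_add, moment_add, moment_const_mul (2 * c) (fun w => w),
    moment_const_mul (c ^ 2) (fun _ => 1)]
  rfl

/-- From `2 |w| ≤ 1 + w²`. The cross term in `E[(W + c)²]` is thereby absorbed into `1 + E[W²]`,
which is why the isothermal estimates are multiplicative in that quantity. -/
theorem IsClassical.two_mul_abs_moment_le {C : Config ι} (hC : C.IsClassical) (k : ι) :
    2 * |C.moment (fun w => w) k| ≤ C.population k + C.moment (fun w => w ^ 2) k := by
  have h1 : C.moment (fun w => 2 * w) k ≤ C.moment (fun w => 1 + w ^ 2) k :=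
    hC.moment_mono (fun w => by nlinarith [sq_nonneg (w - 1)]) k
  have h2 : C.moment (fun w => (-2) * w) k ≤ C.moment (fun w => 1 + w ^ 2) k :=
    hC.moment_mono (fun w => by nlinarith [sq_nonneg (w + 1)]) k
  rw [moment_add, moment_const_mul 2 (fun w => w)] at h1
  rw [moment_add, moment_const_mul (-2) (fun w => w)] at h2
  unfold population
  rcases abs_cases (C.moment (fun w => w) k) with ⟨h, _⟩ | ⟨h, _⟩ <;> rw [h] <;> linarith

theorem IsClassical.moment_add_le_expect {C : Config ι} (hC : C.IsClassical) {g : ℝ → ℝ}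
    (hg : ∀ w, 0 ≤ g w) {i j : ι} (hij : i ≠ j) :
    C.moment g i + C.moment g j ≤ C.expect g := by
  rw [← sum_moment, ← Finset.sum_pair hij]
  exact Finset.sum_le_sum_of_subset_of_nonneg (Finset.subset_univ _)
    fun k _ _ => hC.moment_nonneg hg k

/-- `D` arises from `C` by operations that only redistribute weight and population between the
levels `i` and `j`. -/
structure PairProcess (β : ℝ) (𝒰 : Set (Matrix ι ι ℂ)) (i j : ι) (C D : Config ι) : Prop where
  reach : ReflTransGen (CoarseStep β 𝒰) C D
  classical : D.IsClassical
  total : D.expect (fun _ => 1) = 1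
  weight_of_ne : ∀ k, k ≠ i → k ≠ j → D.weight β k = C.weight β k
  population_of_ne : ∀ k, k ≠ i → k ≠ j → D.population k = C.population k
  population_add : D.population i + D.population j = C.population i + C.population j

theorem PairProcess.refl {β : ℝ} {𝒰 : Set (Matrix ι ι ℂ)} {i j : ι} {C : Config ι}
    (hC : C.IsClassical) (h1 : C.expect (fun _ => 1) = 1) : PairProcess β 𝒰 i j C C :=
  ⟨.refl, hC, h1, fun _ _ _ => rfl, fun _ _ _ => rfl, rfl⟩

theorem PairProcess.trans {β : ℝ} {𝒰 : Set (Matrix ι ι ℂ)} {i j : ι} {C D F : Config ι}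
    (h : PairProcess β 𝒰 i j C D) (h' : PairProcess β 𝒰 i j D F) : PairProcess β 𝒰 i j C F :=
  ⟨h.reach.trans h'.reach, h'.classical, h'.total,
    fun k hi hj => (h'.weight_of_ne k hi hj).trans (h.weight_of_ne k hi hj),
    fun k hi hj => (h'.population_of_ne k hi hj).trans (h.population_of_ne k hi hj),
    h'.population_add.trans h.population_add⟩

theorem PairProcess.plt {β : ℝ} (𝒰 : Set (Matrix ι ι ℂ)) {i j : ι} (hij : i ≠ j) {C : Config ι}
    (hC : C.IsClassical) (h1 : C.expect (fun _ => 1) = 1) {lam : ℝ} (hl0 : 0 ≤ lam)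
    (hl1 : lam ≤ 1) : PairProcess β 𝒰 i j C (C.plt β {i, j} lam) :=
  ⟨.single (.partialLevelThermalization C _ lam hl0 hl1 hC.isDiag), hC.plt β _ hl0 hl1,
    by rw [expect_plt_pair _ β lam C hij, h1], fun _ _ _ => rfl,
    fun _ hi hj => moment_plt_pair_of_ne _ β lam C hi hj, moment_plt_pair_add _ β lam C hij⟩

/-- Thermalise the pair `i, j`, then shift both levels so that the fraction of the pair's Gibbs
weight carried by `i` changes from `f` to `g`. -/
theorem exists_pairProcess_step {β : ℝ} (hβ : 0 < β) (𝒰 : Set (Matrix ι ι ℂ)) {i j : ι}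
    (hij : i ≠ j) {C : Config ι} (hC : C.IsClassical) (h1 : C.expect (fun _ => 1) = 1)
    {κ f g Z : ℝ} (hκ : 0 < κ) (hf : κ ≤ f) (hf' : f ≤ 1 - κ) (hg : κ ≤ g) (hg' : g ≤ 1 - κ)
    (hZ : 0 < Z) (hi : C.weight β i = f * Z) (hj : C.weight β j = (1 - f) * Z) :
    ∃ D, PairProcess β 𝒰 i j C D ∧ D.weight β i = g * Z ∧ D.weight β j = (1 - g) * Z ∧
      1 + D.secondMoment ≤ (1 + C.secondMoment) *
        (1 + (1 / (β * κ ^ 2) + 1 / (β ^ 2 * κ ^ 2)) * (g - f) ^ 2) := by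
  have hf0 : 0 < f := hκ.trans_le hf
  have hg0 : 0 < g := hκ.trans_le hg
  have hf1 : 0 < 1 - f := by linarith
  have hg1 : 0 < 1 - g := by linarith
  set a : ℝ := -Real.log (g / f) / β with ha
  set b : ℝ := -Real.log ((1 - g) / (1 - f)) / β with hb
  set h : ι → ℝ := fun k => if k = i then a else if k = j then b else 0 with hh
  have hhi : h i = a := by simp [hh]
  have hhj : h j = b := by simp [hh, hij.symm]
  have hhk : ∀ k, k ≠ i → k ≠ j → h k = 0 := fun k hi hj => by simp [hh, hi, hj]
  have hP := PairProcess.plt (β := β) 𝒰 hij hC h1 zero_le_one le_rfl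
  set B := C.plt β {i, j} 1 with hB
  -- Full thermalization divides every moment of `W` in the same ratio `f : 1 - f`: within the pair,
  -- the occupied level becomes independent of the work already spent. The cross term in `hdiff`
  -- therefore contains only the mean shift.
  have hmom : ∀ φ : ℝ → ℝ, B.moment φ i = f * (C.moment φ i + C.moment φ j) ∧
      B.moment φ j = (1 - f) * (C.moment φ i + C.moment φ j) := by
    intro φ
    rw [hB, moment_plt_pair_left φ β 1 C hij, moment_plt_pair_right φ β 1 C hij, hi, hj]
    constructor <;> (field_simp; ring)
  have hpop : ∀ k, (B.levelTransform h).population k = B.population k := fun k =>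
    moment_levelTransform _ _ _ _
  refine ⟨B.levelTransform h, ⟨hP.reach.tail (.levelTransformation B h hP.classical.isDiag),
    hP.classical.levelTransform h, ?_, ?_, ?_, ?_⟩, ?_, ?_, ?_⟩
  · rw [← sum_moment]
    simp only [moment_levelTransform]
    rw [sum_moment, hP.total]
  · intro k hki hkj
    rw [weight_levelTransform, hhk k hki hkj, hP.weight_of_ne k hki hkj]
    simp
  · intro k hki hkj
    rw [hpop, hP.population_of_ne k hki hkj]
  · rw [hpop, hpop, hP.population_add]
  · rw [weight_levelTransform, hhi, hB, weight_plt, hi, ha]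
    have : -β * (-Real.log (g / f) / β) = Real.log (g / f) := by field_simp
    rw [this, Real.exp_log (by positivity)]
    field_simp
  · rw [weight_levelTransform, hhj, hB, weight_plt, hj, hb]
    have : -β * (-Real.log ((1 - g) / (1 - f)) / β) = Real.log ((1 - g) / (1 - f)) := by field_simp
    rw [this, Real.exp_log (by positivity)]
    field_simp
  · have hdiff : (B.levelTransform h).secondMoment - C.secondMoment =
        2 * (f * a + (1 - f) * b) * (C.moment (fun w => w) i + C.moment (fun w => w) j) +
          (f * a ^ 2 + (1 - f) * b ^ 2) * (C.population i + C.population j) := by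
      rw [secondMoment, secondMoment, ← sum_moment, ← sum_moment, ← Finset.sum_sub_distrib,
        Fintype.sum_eq_add i j hij]
      · rw [moment_levelTransform, moment_levelTransform, hhi, hhj, (hmom _).1, (hmom _).2]
        simp only [moment_add_sq]
        ring
      · rintro k ⟨hki, hkj⟩
        rw [moment_levelTransform, hhk k hki hkj, hB, moment_plt_pair_of_ne _ β 1 C hki hkj]
        simp
    have hT1 : C.population i + C.population j ≤ 1 :=
      (hC.moment_add_le_expect (fun _ => zero_le_one) hij).trans h1.le
    have hT0 : 0 ≤ C.population i + C.population j :=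
      add_nonneg (hC.moment_nonneg (fun _ => zero_le_one) i)
        (hC.moment_nonneg (fun _ => zero_le_one) j)
    have hT2 : C.moment (fun w => w ^ 2) i + C.moment (fun w => w ^ 2) j ≤ C.secondMoment :=
      hC.moment_add_le_expect (fun _ => sq_nonneg _) hij
    have hm0 : 0 ≤ C.secondMoment :=
      (add_nonneg (hC.moment_nonneg (fun _ => sq_nonneg _) i)
        (hC.moment_nonneg (fun _ => sq_nonneg _) j)).trans hT2
    have hTw : 2 * |C.moment (fun w => w) i + C.moment (fun w => w) j| ≤ 1 + C.secondMoment := by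
      have := abs_add_le (C.moment (fun w => w) i) (C.moment (fun w => w) j)
      have h3 := hC.two_mul_abs_moment_le i
      have h4 := hC.two_mul_abs_moment_le j
      linarith
    have hμ : |f * a + (1 - f) * b| ≤ 1 / (β * κ ^ 2) * (g - f) ^ 2 := by
      have hμ' : f * a + (1 - f) * b =
          -(f * Real.log (g / f) + (1 - f) * Real.log ((1 - g) / (1 - f))) / β := by
        rw [ha, hb]
        ring
      rw [hμ', abs_div, abs_neg, abs_of_pos hβ, div_le_iff₀ hβ]
      refine (abs_relEntropy_le hκ hf hf' hg hg').trans_eq ?_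
      field_simp
    have hsq : ∀ x y : ℝ, κ ≤ x → κ ≤ y → (-Real.log (y / x) / β) ^ 2 ≤
        1 / (β ^ 2 * κ ^ 2) * (y - x) ^ 2 := by
      intro x y hx hy
      have h5 := abs_log_div_le hκ hx hy
      have h6 : Real.log (y / x) ^ 2 ≤ (|y - x| / κ) ^ 2 := by
        rw [← sq_abs (Real.log (y / x))]
        gcongr
      rw [div_pow, neg_sq, div_le_iff₀ (by positivity)]
      refine h6.trans_eq ?_
      rw [div_pow, sq_abs]
      field_simp
    have ha2 := hsq f g hf hg
    have hb2 := hsq (1 - f) (1 - g) (by linarith) (by linarith)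
    rw [← ha] at ha2
    rw [← hb] at hb2
    have hs : f * a ^ 2 + (1 - f) * b ^ 2 ≤ 1 / (β ^ 2 * κ ^ 2) * (g - f) ^ 2 := by
      have : (1 - g - (1 - f)) ^ 2 = (g - f) ^ 2 := by ring
      rw [this] at hb2
      nlinarith [mul_le_mul_of_nonneg_left ha2 hf0.le, mul_le_mul_of_nonneg_left hb2 hf1.le]
    have hs0 : 0 ≤ f * a ^ 2 + (1 - f) * b ^ 2 := by positivity
    have e1 : 2 * (f * a + (1 - f) * b) * (C.moment (fun w => w) i + C.moment (fun w => w) j) ≤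
        1 / (β * κ ^ 2) * (g - f) ^ 2 * (1 + C.secondMoment) := by
      calc _ ≤ |2 * (f * a + (1 - f) * b) *
              (C.moment (fun w => w) i + C.moment (fun w => w) j)| := le_abs_self _
        _ = |f * a + (1 - f) * b| *
              (2 * |C.moment (fun w => w) i + C.moment (fun w => w) j|) := by
            rw [abs_mul, abs_mul, abs_two]
            ring
        _ ≤ _ := by gcongr
    have e2 : (f * a ^ 2 + (1 - f) * b ^ 2) * (C.population i + C.population j) ≤
        1 / (β ^ 2 * κ ^ 2) * (g - f) ^ 2 * (1 + C.secondMoment) := by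
      refine mul_le_mul hs (by linarith) hT0 (hs0.trans hs)
    linarith

/-- Reversible isothermal process: the fraction of the Gibbs weight of the pair `i, j` carried by
`i` can be changed to any `θ ∈ (0, 1)` at arbitrarily small cost. -/
theorem exists_isothermal {β : ℝ} (hβ : 0 < β) (𝒰 : Set (Matrix ι ι ℂ)) {i j : ι}
    (hij : i ≠ j) {C : Config ι} (hC : C.IsClassical) (h1 : C.expect (fun _ => 1) = 1)
    {θ : ℝ} (hθ0 : 0 < θ) (hθ1 : θ < 1) {ε : ℝ} (hε : 0 < ε) :
    ∃ D, PairProcess β 𝒰 i j C D ∧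
      D.weight β i = θ * (C.weight β i + C.weight β j) ∧
      D.weight β j = (1 - θ) * (C.weight β i + C.weight β j) ∧
      D.population i = θ * (C.population i + C.population j) ∧
      D.population j = (1 - θ) * (C.population i + C.population j) ∧
      D.secondMoment ≤ C.secondMoment + ε := by
  have hwi := C.weight_pos β i
  have hwj := C.weight_pos β j
  set Z := C.weight β i + C.weight β j with hZ
  have hZ0 : 0 < Z := add_pos hwi hwj
  set f := C.weight β i / Z with hf
  have hfZ : C.weight β i = f * Z := by rw [hf]; field_simp
  have hfZ' : C.weight β j = (1 - f) * Z := by rw [sub_mul, ← hfZ, hZ]; ring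
  have hf0 : 0 < f := div_pos hwi hZ0
  have hf1 : f < 1 := by rw [hf, div_lt_one hZ0]; linarith
  -- Keeps the whole segment from `f` to `θ` away from 0 and 1, so that the constant `K` serves all
  -- steps.
  obtain ⟨κ, hκ, hκf, hκf', hκθ, hκθ'⟩ : ∃ κ : ℝ, 0 < κ ∧ κ ≤ f ∧ f ≤ 1 - κ ∧ κ ≤ θ ∧
      θ ≤ 1 - κ := by
    refine ⟨min (min f (1 - f)) (min θ (1 - θ)), ?_, ?_, ?_, ?_, ?_⟩
    · have : 0 < 1 - f := by linarith
      have : 0 < 1 - θ := by linarith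
      positivity
    · exact (min_le_left _ _).trans (min_le_left _ _)
    · linarith [(min_le_left (min f (1 - f)) (min θ (1 - θ))).trans (min_le_right f (1 - f))]
    · exact (min_le_right _ _).trans (min_le_left _ _)
    · linarith [(min_le_right (min f (1 - f)) (min θ (1 - θ))).trans (min_le_right θ (1 - θ))]
  set K : ℝ := 1 / (β * κ ^ 2) + 1 / (β ^ 2 * κ ^ 2) with hK
  have hK0 : 0 ≤ K := by positivity
  have hm0 : 0 ≤ C.secondMoment := by
    rw [secondMoment, ← sum_moment]
    exact Finset.sum_nonneg fun k _ => hC.moment_nonneg (fun _ => sq_nonneg _) k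
  -- With `N` steps of length at most `1 / N`, the quantity `1 + E[W²]` grows by at most `(1 + K /
  -- N²) ^ N ≤ exp (K / N)`, which tends to 1.
  obtain ⟨N, hN0, hN⟩ : ∃ N : ℕ, 0 < N ∧ (1 + C.secondMoment) * Real.exp (K / N) <
      1 + C.secondMoment + ε := by
    have ht : Filter.Tendsto (fun N : ℕ => (1 + C.secondMoment) * Real.exp (K / N)) Filter.atTop
        (nhds ((1 + C.secondMoment) * Real.exp 0)) :=
      ((Real.continuous_exp.tendsto _).comp
        (tendsto_const_div_atTop_nhds_zero_nat K)).const_mul _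
    rw [Real.exp_zero, mul_one] at ht
    exact ((Filter.eventually_gt_atTop 0).and
      (ht.eventually_lt_const (lt_add_of_pos_right _ hε))).exists
  have hN' : (0 : ℝ) < N := by exact_mod_cast hN0
  have hpath : ∀ k : ℕ, k ≤ N → ∃ D, PairProcess β 𝒰 i j C D ∧
      D.weight β i = (f + (θ - f) * (k / N)) * Z ∧
      D.weight β j = (1 - (f + (θ - f) * (k / N))) * Z ∧
      1 + D.secondMoment ≤ (1 + C.secondMoment) * (1 + K / N ^ 2) ^ k := by
    intro k
    induction k with
    | zero =>
      intro _
      exact ⟨C, .refl hC h1, by simpa using hfZ, by simpa using hfZ', by simp⟩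
    | succ k ih =>
      intro hk
      obtain ⟨D, hD, hDi, hDj, hDm⟩ := ih (by omega)
      have hbd : ∀ l : ℕ, l ≤ N → κ ≤ f + (θ - f) * (l / N) ∧ f + (θ - f) * (l / N) ≤ 1 - κ := by
        intro l hl
        have hl0 : (0 : ℝ) ≤ l / N := by positivity
        have hl1 : (l : ℝ) / N ≤ 1 := by
          rw [div_le_one hN']
          exact_mod_cast hl
        generalize (l : ℝ) / N = t at hl0 hl1
        have e1 := mul_nonneg hl0 (sub_nonneg.2 hκθ)
        have e2 := mul_nonneg (sub_nonneg.2 hl1) (sub_nonneg.2 hκf)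
        have e3 := mul_nonneg hl0 (sub_nonneg.2 hκθ')
        have e4 := mul_nonneg (sub_nonneg.2 hl1) (sub_nonneg.2 hκf')
        constructor <;> linarith
      obtain ⟨F, hF, hFi, hFj, hFm⟩ := exists_pairProcess_step hβ 𝒰 hij hD.classical hD.total hκ
        (hbd k (by omega)).1 (hbd k (by omega)).2 (hbd (k + 1) hk).1 (hbd (k + 1) hk).2 hZ0 hDi hDj
      refine ⟨F, hD.trans hF, hFi, hFj, hFm.trans ?_⟩
      have hstep : (f + (θ - f) * (((k + 1 : ℕ) : ℝ) / N) - (f + (θ - f) * (k / N))) ^ 2 ≤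
          1 / N ^ 2 := by
        have : f + (θ - f) * (((k + 1 : ℕ) : ℝ) / N) - (f + (θ - f) * (k / N)) = (θ - f) / N := by
          push_cast
          ring
        rw [this, div_pow]
        gcongr
        rw [sq_le_one_iff_abs_le_one, abs_le]
        constructor <;> linarith
      rw [pow_succ (1 + K / (N : ℝ) ^ 2) k, ← mul_assoc]
      refine mul_le_mul hDm ?_ (by positivity) (by positivity)
      rw [div_eq_mul_one_div K]
      gcongr
  obtain ⟨D, hD, hDi, hDj, hDm⟩ := hpath N le_rfl
  rw [div_self hN'.ne'] at hDi hDj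
  -- The last shift changed the weights but not the populations; one more full thermalization brings
  -- these to the ratio `θ : 1 - θ`.
  have hP := PairProcess.plt (β := β) 𝒰 hij hD.classical hD.total zero_le_one le_rfl
  have e1 : f + (θ - f) * 1 = θ := by ring
  rw [e1] at hDi hDj
  refine ⟨_, hD.trans hP, hDi, hDj, ?_, ?_, ?_⟩
  · rw [population, moment_plt_pair_left _ β 1 D hij, hDi, hDj, ← hD.population_add]
    unfold population
    field_simp
    ring
  · rw [population, moment_plt_pair_right _ β 1 D hij, hDi, hDj, ← hD.population_add]
    unfold population
    field_simp
    ring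
  · rw [secondMoment, expect_plt_pair _ β 1 D hij]
    have hexp : (1 + K / N ^ 2) ^ N ≤ Real.exp (K / N) := by
      calc (1 + K / N ^ 2) ^ N ≤ Real.exp (K / N ^ 2) ^ N := by
            gcongr
            rw [add_comm]
            exact Real.add_one_le_exp _
        _ = Real.exp (K / N) := by
            rw [← Real.exp_nat_mul]
            congr 1
            field_simp
    have : (1 + C.secondMoment) * (1 + K / N ^ 2) ^ N ≤
        (1 + C.secondMoment) * Real.exp (K / N) := by gcongr
    unfold secondMoment at *
    linarith

end Config

end CoarseThermo

namespace CoarseThermo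

open Relation Filter Topology

/-! ### Configurations attainable at no work cost -/

variable {ι : Type} [Fintype ι] [DecidableEq ι]

/-- Levels are described by vectors `(population, Gibbs weight)`. The description `s` together with
a bound on the second moment of the work is realizable if some protocol produces it exactly. -/
def realizable (β : ℝ) (𝒰 : Set (Matrix ι ι ℂ)) (C : Config ι) : Set ((ι → ℝ × ℝ) × ℝ) :=
  {t | ∃ D, ReflTransGen (CoarseStep β 𝒰) C D ∧ D.IsClassical ∧ D.expect (fun _ => 1) = 1 ∧
    (∀ k, t.1 k = (D.population k, D.weight β k)) ∧ D.secondMoment ≤ t.2}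

/-- The description `s` can be approached at a work cost whose second moment tends to zero.
Limits with vanishing Gibbs weights are allowed. -/
def Attainable (β : ℝ) (𝒰 : Set (Matrix ι ι ℂ)) (C : Config ι) (s : ι → ℝ × ℝ) : Prop :=
  (s, (0 : ℝ)) ∈ closure (realizable β 𝒰 C)

/-- Replace the values at `i` and `j`. -/
def setPair {α : Type*} (i j : ι) (u v : α) (s : ι → α) : ι → α :=
  Function.update (Function.update s i u) j v

theorem setPair_left {α : Type*} {i j : ι} (hij : i ≠ j) (u v : α) (s : ι → α) :
    setPair i j u v s i = u := by
  simp [setPair, hij]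

theorem setPair_right {α : Type*} (i j : ι) (u v : α) (s : ι → α) :
    setPair i j u v s j = v := by
  simp [setPair]

theorem setPair_of_ne {α : Type*} {i j k : ι} (hi : k ≠ i) (hj : k ≠ j) (u v : α) (s : ι → α) :
    setPair i j u v s k = s k := by
  simp [setPair, hi, hj]

theorem eq_setPair {α : Type*} {i j : ι} {u v : α} {s s' : ι → α} (hi : s' i = u) (hj : s' j = v)
    (h : ∀ k, k ≠ i → k ≠ j → s' k = s k) : s' = setPair i j u v s := by
  funext k
  by_cases hkj : k = j
  · subst hkj
    rw [setPair_right, hj]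
  · by_cases hki : k = i
    · subst hki
      rw [setPair_left hkj, hi]
    · rw [setPair_of_ne hki hkj, h k hki hkj]

variable {β : ℝ} {𝒰 : Set (Matrix ι ι ℂ)} {C : Config ι} {s : ι → ℝ × ℝ}

theorem mem_realizable_of_pairProcess {D F : Config ι} {i j : ι}
    (hD : ReflTransGen (CoarseStep β 𝒰) C D) (hF : Config.PairProcess β 𝒰 i j D F)
    (hs : ∀ k, s k = (D.population k, D.weight β k)) {u v : ℝ × ℝ}
    (hu : u = (F.population i, F.weight β i)) (hv : v = (F.population j, F.weight β j))
    {m : ℝ} (hm : F.secondMoment ≤ m) : (setPair i j u v s, m) ∈ realizable β 𝒰 C := by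
  refine ⟨F, hD.trans hF.reach, hF.classical, hF.total, ?_, hm⟩
  have : (fun k => (F.population k, F.weight β k)) = setPair i j u v s :=
    eq_setPair hu.symm hv.symm fun k hki hkj => by
      rw [hs k, hF.population_of_ne k hki hkj, hF.weight_of_ne k hki hkj]
  exact fun k => (congrFun this k).symm

/-- For `0 < θ < 1` the isothermal process realises the move up to an arbitrarily small increase of
the second moment, and the move is continuous, so it passes to the closure. Continuity in `θ` then
adds the end points, where one of the weights tends to zero. -/
theorem Attainable.rebalance (hβ : 0 < β) (hs : Attainable β 𝒰 C s) {i j : ι} (hij : i ≠ j)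
    {θ : ℝ} (h0 : 0 ≤ θ) (h1 : θ ≤ 1) :
    Attainable β 𝒰 C (setPair i j (θ • (s i + s j)) ((1 - θ) • (s i + s j)) s) := by
  have hθ : θ ∈ closure (Set.Ioo (0 : ℝ) 1) := by
    rw [closure_Ioo zero_ne_one]
    exact ⟨h0, h1⟩
  let Φ : ℝ → (ι → ℝ × ℝ) × ℝ → (ι → ℝ × ℝ) × ℝ := fun θ t =>
    (setPair i j (θ • (t.1 i + t.1 j)) ((1 - θ) • (t.1 i + t.1 j)) t.1, t.2)
  have hΦ : Continuous fun p : ℝ × ((ι → ℝ × ℝ) × ℝ) => Φ p.1 p.2 := by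
    refine Continuous.prodMk ?_ (by fun_prop)
    unfold setPair
    refine Continuous.update (Continuous.update (by fun_prop) _ (by fun_prop)) _ (by fun_prop)
  have hmaps : ∀ η ∈ Set.Ioo (0 : ℝ) 1,
      Set.MapsTo (Φ η) (realizable β 𝒰 C) (closure (realizable β 𝒰 C)) := by
    rintro η ⟨hη0, hη1⟩ ⟨t, m⟩ ⟨D, hD, hcl, htot, ht, hm⟩
    dsimp only at ht hm
    have hmem : ∀ ε : ℝ, 0 < ε → ((Φ η (t, m)).1, m + ε) ∈ realizable β 𝒰 C := by
      intro ε hε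
      obtain ⟨F, hF, hwi, hwj, hpi, hpj, hFm⟩ :=
        Config.exists_isothermal hβ 𝒰 hij hcl htot hη0 hη1 hε
      refine mem_realizable_of_pairProcess hD hF ht ?_ ?_ (by linarith)
      · dsimp only
        rw [ht i, ht j, hpi, hwi]
        rfl
      · dsimp only
        rw [ht i, ht j, hpj, hwj]
        rfl
    have htend : Tendsto (fun ε : ℝ => ((Φ η (t, m)).1, m + ε)) (𝓝[>] 0)
        (𝓝 ((Φ η (t, m)).1, m + 0)) :=
      ((continuous_const.prodMk (continuous_const.add continuous_id)).tendsto 0).mono_left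
        nhdsWithin_le_nhds
    rw [add_zero] at htend
    exact mem_closure_of_tendsto htend (eventually_mem_nhdsWithin.mono fun ε hε => hmem ε hε)
  have hcl : ∀ η ∈ Set.Ioo (0 : ℝ) 1, Φ η (s, 0) ∈ closure (realizable β 𝒰 C) := by
    intro η hη
    have hc : Continuous (Φ η) := hΦ.comp (continuous_const.prodMk continuous_id)
    have := (hmaps η hη).closure hc hs
    rwa [closure_closure] at this
  have hc : Continuous fun η => Φ η (s, 0) := hΦ.comp (continuous_id.prodMk continuous_const)
  have := map_mem_closure hc hθ hcl
  rwa [closure_closure] at this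

/-- The effect of a partial level thermalization of two levels on the first one. -/
noncomputable def partialMix (lam : ℝ) (u v : ℝ × ℝ) : ℝ × ℝ :=
  ((1 - lam) * u.1 + lam * u.2 / (u.2 + v.2) * (u.1 + v.1), u.2)

/-- One thermalization realises the move exactly and without work. It extends to limiting
descriptions by continuity, which needs the total weight of the pair to be nonzero. -/
theorem Attainable.partialMix (hs : Attainable β 𝒰 C s) {i j : ι} (hij : i ≠ j)
    {lam : ℝ} (h0 : 0 ≤ lam) (h1 : lam ≤ 1) (hw : (s i).2 + (s j).2 ≠ 0) :
    Attainable β 𝒰 C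
      (setPair i j (partialMix lam (s i) (s j)) (partialMix lam (s j) (s i)) s) := by
  let Φ : (ι → ℝ × ℝ) × ℝ → (ι → ℝ × ℝ) × ℝ := fun t =>
    (setPair i j (CoarseThermo.partialMix lam (t.1 i) (t.1 j))
      (CoarseThermo.partialMix lam (t.1 j) (t.1 i)) t.1, t.2)
  have hmix : ∀ k l, (s k).2 + (s l).2 ≠ 0 →
      ContinuousAt (fun t : (ι → ℝ × ℝ) × ℝ => CoarseThermo.partialMix lam (t.1 k) (t.1 l))
        (s, 0) := by
    intro k l hkl
    unfold CoarseThermo.partialMix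
    refine ContinuousAt.prodMk ?_ (by fun_prop)
    refine ContinuousAt.add (by fun_prop) (ContinuousAt.mul ?_ (by fun_prop))
    exact ContinuousAt.div (by fun_prop) (by fun_prop) hkl
  have hΦ : ContinuousAt Φ (s, 0) := by
    refine ContinuousAt.prodMk ?_ (by fun_prop)
    unfold setPair
    exact ContinuousAt.update (ContinuousAt.update (by fun_prop) _ (hmix i j hw)) _
      (hmix j i (by rwa [add_comm]))
  refine hΦ.continuousWithinAt.mem_closure hs ?_
  rintro ⟨t, m⟩ ⟨D, hD, hcl, htot, ht, hm⟩
  dsimp only at ht hm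
  refine mem_realizable_of_pairProcess hD (Config.PairProcess.plt 𝒰 hij hcl htot h0 h1) ht ?_ ?_ ?_
  · dsimp only
    rw [ht i, ht j]
    unfold Config.population CoarseThermo.partialMix
    rw [Config.moment_plt_pair_left _ β lam D hij]
    rfl
  · dsimp only
    rw [ht i, ht j]
    unfold Config.population CoarseThermo.partialMix
    rw [Config.moment_plt_pair_right _ β lam D hij, add_comm (D.moment _ i),
      add_comm (D.weight β i)]
    rfl
  · rwa [Config.secondMoment, Config.expect_plt_pair _ β lam D hij]

end CoarseThermo

namespace CoarseThermo

open Relation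

/-! ### Redistribution of population and weight, forgetting labels -/

/-- Elementary moves on a multiset of vectors `(population, Gibbs weight)`. -/
inductive Flow : Multiset (ℝ × ℝ) → Multiset (ℝ × ℝ) → Prop
  | rebalance (u v : ℝ × ℝ) (S : Multiset (ℝ × ℝ)) (θ : ℝ) (h0 : 0 ≤ θ) (h1 : θ ≤ 1) :
      Flow (u ::ₘ v ::ₘ S) (θ • (u + v) ::ₘ (1 - θ) • (u + v) ::ₘ S)
  | mix (u v : ℝ × ℝ) (S : Multiset (ℝ × ℝ)) (lam : ℝ) (h0 : 0 ≤ lam) (h1 : lam ≤ 1)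
      (hw : u.2 + v.2 ≠ 0) :
      Flow (u ::ₘ v ::ₘ S) (partialMix lam u v ::ₘ partialMix lam v u ::ₘ S)

/-- Finite sequences of elementary moves. -/
def Flows : Multiset (ℝ × ℝ) → Multiset (ℝ × ℝ) → Prop := ReflTransGen Flow

theorem Flow.add_right {S T : Multiset (ℝ × ℝ)} (h : Flow S T) (F : Multiset (ℝ × ℝ)) :
    Flow (S + F) (T + F) := by
  cases h with
  | rebalance u v S θ h0 h1 =>
    simp only [Multiset.cons_add]
    exact .rebalance u v _ θ h0 h1
  | mix u v S lam h0 h1 hw =>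
    simp only [Multiset.cons_add]
    exact .mix u v _ lam h0 h1 hw

theorem Flow.card_eq {S T : Multiset (ℝ × ℝ)} (h : Flow S T) : T.card = S.card := by
  cases h <;> simp

theorem Flows.refl (S : Multiset (ℝ × ℝ)) : Flows S S := ReflTransGen.refl

theorem Flows.trans {S T R : Multiset (ℝ × ℝ)} (h : Flows S T) (h' : Flows T R) : Flows S R :=
  ReflTransGen.trans h h'

theorem Flows.add_right {S T : Multiset (ℝ × ℝ)} (h : Flows S T) (F : Multiset (ℝ × ℝ)) :
    Flows (S + F) (T + F) :=
  ReflTransGen.lift (p := Flow) (· + F) (fun _ _ h => Flow.add_right h F) _ _ h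

theorem Flows.card_eq {S T : Multiset (ℝ × ℝ)} (h : Flows S T) : T.card = S.card := by
  induction h with
  | refl => rfl
  | tail _ h ih => exact h.card_eq.trans ih

theorem Flows.merge (u v : ℝ × ℝ) (S : Multiset (ℝ × ℝ)) :
    Flows (u ::ₘ v ::ₘ S) ((u + v) ::ₘ 0 ::ₘ S) := by
  have := Flow.rebalance u v S 1 zero_le_one le_rfl
  rw [one_smul, sub_self, zero_smul] at this
  exact .single this

theorem Flows.split (u : ℝ × ℝ) (S : Multiset (ℝ × ℝ)) {t : ℝ} (h0 : 0 ≤ t) (h1 : t ≤ 1) :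
    Flows (u ::ₘ 0 ::ₘ S) (t • u ::ₘ (1 - t) • u ::ₘ S) := by
  have := Flow.rebalance u 0 S t h0 h1
  rw [add_zero] at this
  exact .single this

/-- Partial thermalization moves the amount `lam (x v - y w) / (w + v)`. Solving for `lam`, the
bound `lam ≤ 1` is exactly the hypothesis that the first level remains at least as dense as the
second. -/
theorem Flows.transfer {x w y v δ : ℝ} (hw : 0 < w) (hv : 0 < v) (hδ : 0 ≤ δ)
    (h : (y + δ) * w ≤ (x - δ) * v) (S : Multiset (ℝ × ℝ)) :
    Flows ((x, w) ::ₘ (y, v) ::ₘ S) ((x - δ, w) ::ₘ (y + δ, v) ::ₘ S) := by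
  rcases hδ.eq_or_lt with rfl | hδ
  · simpa using Flows.refl _
  have hpos : 0 < x * v - y * w := by nlinarith [mul_pos hδ (add_pos hw hv)]
  have := Flow.mix (x, w) (y, v) S (δ * (w + v) / (x * v - y * w)) (by positivity)
    (by rw [div_le_one hpos]; linarith) (by dsimp only; positivity)
  have e1 : partialMix (δ * (w + v) / (x * v - y * w)) (x, w) (y, v) = (x - δ, w) := by
    unfold partialMix
    ext
    · set D := x * v - y * w with hD
      field_simp
      rw [hD]
      ring
    · rfl
  have e2 : partialMix (δ * (w + v) / (x * v - y * w)) (y, v) (x, w) = (y + δ, v) := by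
    unfold partialMix
    ext
    · rw [add_comm v w]
      set D := x * v - y * w with hD
      field_simp
      rw [hD]
      ring
    · rfl
  rw [e1, e2] at this
  exact .single this

/-! ### Cutting off the top of a sorted list of levels -/

/-- The population in excess of the density `c`. -/
noncomputable def excess (c : ℝ) (l : List (ℝ × ℝ)) : ℝ :=
  (l.map fun v => max (v.1 - c * v.2) 0).sum

theorem excess_cons (c : ℝ) (v : ℝ × ℝ) (l : List (ℝ × ℝ)) :
    excess c (v :: l) = max (v.1 - c * v.2) 0 + excess c l := rfl

theorem excess_eq_zero {c : ℝ} {l : List (ℝ × ℝ)} (h : ∀ v ∈ l, v.1 ≤ c * v.2) :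
    excess c l = 0 := by
  refine List.sum_eq_zero fun x hx => ?_
  obtain ⟨v, hv, rfl⟩ := List.mem_map.1 hx
  exact max_eq_right (by linarith [h v hv])

/-- Positive weights, and densities in decreasing order. -/
def DensitySorted (l : List (ℝ × ℝ)) : Prop :=
  (∀ v ∈ l, 0 < v.2) ∧ l.Pairwise fun u v => v.1 * u.2 ≤ u.1 * v.2

theorem DensitySorted.tail {v : ℝ × ℝ} {l : List (ℝ × ℝ)} (h : DensitySorted (v :: l)) :
    DensitySorted l :=
  ⟨fun u hu => h.1 u (List.mem_cons_of_mem _ hu), h.2.of_cons⟩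

theorem DensitySorted.le_head {v : ℝ × ℝ} {l : List (ℝ × ℝ)} (h : DensitySorted (v :: l))
    {u : ℝ × ℝ} (hu : u ∈ v :: l) : u.1 ≤ v.1 / v.2 * u.2 := by
  have hv : 0 < v.2 := h.1 v List.mem_cons_self
  rcases List.mem_cons.1 hu with rfl | hu
  · rw [div_mul_cancel₀ _ hv.ne']
  · rw [div_mul_eq_mul_div, le_div_iff₀ hv]
    exact (List.pairwise_cons.1 h.2).1 u hu

theorem DensitySorted.smul_head {v : ℝ × ℝ} {l : List (ℝ × ℝ)} (h : DensitySorted (v :: l))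
    {t : ℝ} (ht : 0 < t) : DensitySorted (t • v :: l) := by
  refine ⟨fun u hu => ?_, List.pairwise_cons.2 ⟨fun u hu => ?_, h.2.of_cons⟩⟩
  · rcases List.mem_cons.1 hu with rfl | hu
    · exact mul_pos ht (h.1 v List.mem_cons_self)
    · exact h.1 u (List.mem_cons_of_mem _ hu)
  · have := (List.pairwise_cons.1 h.2).1 u hu
    simp only [Prod.smul_fst, Prod.smul_snd, smul_eq_mul]
    nlinarith

theorem DensitySorted.weight_nonneg {l : List (ℝ × ℝ)} (h : DensitySorted l) :
    0 ≤ (l.map Prod.snd).sum := by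
  refine List.sum_nonneg fun x hx => ?_
  obtain ⟨v, hv, rfl⟩ := List.mem_map.1 hx
  exact (h.1 v hv).le

/-- `l'` is what remains of `l` when the densest part, of weight `b` and population `y`, is
removed; `c` separates the densities. -/
structure IsCut (l l' : List (ℝ × ℝ)) (b y c : ℝ) : Prop where
  sorted : DensitySorted l'
  le : ∀ v ∈ l', v.1 ≤ c * v.2
  weight : (l.map Prod.snd).sum = b + (l'.map Prod.snd).sum
  population : (l.map Prod.fst).sum = y + (l'.map Prod.fst).sum
  eq : y = c * b + excess c l
  excess_eq : ∀ c' ≤ c, excess c' l = y - c' * b + excess c' l'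

/-- The cut falls inside the densest level, whose density is the threshold; nothing exceeds it, so
the excess vanishes. In general the field `eq` places `y` on the Lorenz curve of the list at `b`,
with `c` as supporting slope. -/
theorem IsCut.of_lt {v : ℝ × ℝ} {l : List (ℝ × ℝ)} (h : DensitySorted (v :: l)) {b : ℝ}
    (hb0 : 0 ≤ b) (hb : b < v.2) :
    IsCut (v :: l) ((1 - b / v.2) • v :: l) b (b / v.2 * v.1) (v.1 / v.2) := by
  have hv : 0 < v.2 := hb0.trans_lt hb
  have ht : 0 < 1 - b / v.2 := by rw [sub_pos, div_lt_one hv]; exact hb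
  have hsort := h.smul_head ht
  refine ⟨hsort, ?_, ?_, ?_, ?_, ?_⟩
  · intro u hu
    rcases List.mem_cons.1 hu with rfl | hu
    · simp only [Prod.smul_fst, Prod.smul_snd, smul_eq_mul]
      refine le_of_eq ?_
      field_simp
    · exact h.le_head (List.mem_cons_of_mem _ hu)
  · simp only [List.map_cons, List.sum_cons, Prod.smul_snd, smul_eq_mul]
    field_simp
    ring
  · simp only [List.map_cons, List.sum_cons, Prod.smul_fst, smul_eq_mul]
    ring
  · rw [excess_eq_zero fun u hu => h.le_head hu]
    ring
  · intro c' hc'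
    rw [le_div_iff₀ hv] at hc'
    have h1 : 0 ≤ v.1 - c' * v.2 := by linarith
    rw [excess_cons, excess_cons]
    simp only [Prod.smul_fst, Prod.smul_snd, smul_eq_mul]
    have h2 : (1 - b / v.2) * v.1 - c' * ((1 - b / v.2) * v.2) =
      (1 - b / v.2) * (v.1 - c' * v.2) := by ring
    rw [h2, max_eq_left h1, max_eq_left (mul_nonneg ht.le h1)]
    have h3 : b = b / v.2 * v.2 := by field_simp
    generalize b / v.2 = t at h3
    rw [h3]
    ring

theorem IsCut.cons {v : ℝ × ℝ} {l l' : List (ℝ × ℝ)} (h : DensitySorted (v :: l)) {b y c : ℝ}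
    (hcut : IsCut l l' b y c) (hc : c ≤ v.1 / v.2) :
    IsCut (v :: l) l' (v.2 + b) (v.1 + y) c := by
  have hv : 0 < v.2 := h.1 v List.mem_cons_self
  have hmax : ∀ c' ≤ c, max (v.1 - c' * v.2) 0 = v.1 - c' * v.2 := by
    intro c' hc'
    have := hc'.trans hc
    rw [le_div_iff₀ hv] at this
    exact max_eq_left (by linarith)
  refine ⟨hcut.sorted, hcut.le, ?_, ?_, ?_, ?_⟩
  · rw [List.map_cons, List.sum_cons, hcut.weight, add_assoc]
  · rw [List.map_cons, List.sum_cons, hcut.population, add_assoc]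
  · rw [excess_cons, hmax c le_rfl]
    linarith [hcut.eq]
  · intro c' hc'
    rw [excess_cons, hmax c' hc', hcut.excess_eq c' hc']
    ring

/-- The accumulator `a` swallows whole levels, each leaving a zero vector behind, until the cut
falls inside a level; splitting that one uses the spare zero. The bound `d` on the densities passes
to the threshold, as `IsCut.cons` requires. -/
theorem exists_cut_merge (l : List (ℝ × ℝ)) (hl : DensitySorted l) (a : ℝ × ℝ) {b : ℝ}
    (hb0 : 0 ≤ b) (hb : b ≤ (l.map Prod.snd).sum) {d : ℝ} (hd : ∀ v ∈ l, v.1 ≤ d * v.2) :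
    ∃ l' y c z, IsCut l l' b y c ∧ c ≤ d ∧
      Flows (a ::ₘ 0 ::ₘ (l : Multiset (ℝ × ℝ)))
        ((a + (y, b)) ::ₘ ((l' : Multiset (ℝ × ℝ)) + Multiset.replicate (z + 1) 0)) := by
  induction l generalizing a b d with
  | nil =>
    have : b = 0 := le_antisymm (by simpa using hb) hb0
    subst this
    refine ⟨[], 0, d, 0, ⟨hl, by simp, by simp, by simp, by simp [excess], by simp [excess]⟩,
      le_rfl, ?_⟩
    have e : ((0 : ℝ), (0 : ℝ)) = 0 := rfl
    rw [e, add_zero]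
    exact Flows.refl _
  | cons v l ih =>
    have hv : 0 < v.2 := hl.1 v List.mem_cons_self
    have hvd : v.1 / v.2 ≤ d := by
      rw [div_le_iff₀ hv]
      exact hd v List.mem_cons_self
    rcases lt_or_ge b v.2 with hbv | hbv
    · refine ⟨_, _, _, 0, .of_lt hl hb0 hbv, hvd, ?_⟩
      have h1 := Flows.split v (a ::ₘ (l : Multiset (ℝ × ℝ))) (t := b / v.2) (by positivity)
        ((div_le_one hv).2 hbv.le)
      have h2 := Flows.merge a ((b / v.2) • v) ((1 - b / v.2) • v ::ₘ (l : Multiset (ℝ × ℝ)))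
      have e : (b / v.2) • v = (b / v.2 * v.1, b) := by
        ext
        · rfl
        · simp only [Prod.smul_snd, smul_eq_mul]
          field_simp
      rw [e] at h1 h2
      convert h1.trans (S := v ::ₘ 0 ::ₘ a ::ₘ (l : Multiset (ℝ × ℝ))) ?_ using 1
      · rw [← Multiset.cons_coe, Multiset.cons_swap 0 v, Multiset.cons_swap a v,
          Multiset.cons_swap a 0]
      · convert h2 using 1
        · rw [Multiset.cons_swap _ a, Multiset.cons_swap _ a]
        · simp only [zero_add, Multiset.replicate_one, ← Multiset.cons_coe]
          rw [add_comm _ {0}, Multiset.singleton_add]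
    · rw [List.map_cons, List.sum_cons] at hb
      obtain ⟨l', y, c, z, hcut, hc, hflow⟩ := ih hl.tail (a + v) (sub_nonneg.2 hbv)
        (by linarith) (fun u hu => hl.le_head (List.mem_cons_of_mem _ hu))
      have hcut' := hcut.cons hl hc
      rw [add_sub_cancel] at hcut'
      refine ⟨l', v.1 + y, c, z + 1, hcut', hc.trans hvd, ?_⟩
      have h1 := Flows.merge a v (0 ::ₘ (l : Multiset (ℝ × ℝ)))
      have h2 := hflow.add_right {0}
      convert h1.trans (R := ((a + v + (y, b - v.2)) ::ₘ
        ((l' : Multiset (ℝ × ℝ)) + Multiset.replicate (z + 1) 0)) + {0}) ?_ using 1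
      · rw [← Multiset.cons_coe, Multiset.cons_swap 0 v]
      · have e : a + v + (y, b - v.2) = a + (v.1 + y, b) := by
          ext
          · simp [add_assoc]
          · simp [add_assoc]
        rw [e, Multiset.cons_add, Multiset.replicate_succ _ (z + 1), Multiset.add_cons,
          add_comm _ {(0 : ℝ × ℝ)}, Multiset.singleton_add]
      · convert h2 using 1
        rw [add_comm _ {(0 : ℝ × ℝ)}, Multiset.singleton_add, Multiset.cons_swap 0 (a + v)]

/-- The first level serves as accumulator, so a single spare zero suffices for each block. -/
theorem exists_cut (l : List (ℝ × ℝ)) (hl : DensitySorted l) {b : ℝ} (hb0 : 0 < b)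
    (hb : b ≤ (l.map Prod.snd).sum) :
    ∃ l' y c z, IsCut l l' b y c ∧
      Flows ((l : Multiset (ℝ × ℝ)) + {0})
        ((y, b) ::ₘ ((l' : Multiset (ℝ × ℝ)) + Multiset.replicate z 0)) := by
  cases l with
  | nil => simp at hb; linarith
  | cons v l =>
    have hv : 0 < v.2 := hl.1 v List.mem_cons_self
    rcases lt_or_ge b v.2 with hbv | hbv
    · refine ⟨_, _, _, 0, .of_lt hl hb0.le hbv, ?_⟩
      have h1 := Flows.split v (l : Multiset (ℝ × ℝ)) (t := b / v.2) (by positivity)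
        ((div_le_one hv).2 hbv.le)
      have e : (b / v.2) • v = (b / v.2 * v.1, b) := by
        ext
        · rfl
        · simp only [Prod.smul_snd, smul_eq_mul]
          field_simp
      rw [e] at h1
      convert h1 using 1
      · rw [← Multiset.cons_coe, Multiset.cons_add, add_comm _ {(0 : ℝ × ℝ)},
          Multiset.singleton_add]
      · simp
    · rw [List.map_cons, List.sum_cons] at hb
      obtain ⟨l', y, c, z, hcut, hc, hflow⟩ := exists_cut_merge l hl.tail v (sub_nonneg.2 hbv)
        (by linarith) (fun u hu => hl.le_head (List.mem_cons_of_mem _ hu))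
      have hcut' := hcut.cons hl hc
      rw [add_sub_cancel] at hcut'
      refine ⟨l', v.1 + y, c, z + 1, hcut', ?_⟩
      convert hflow using 1
      · rw [← Multiset.cons_coe, Multiset.cons_add, add_comm _ {(0 : ℝ × ℝ)},
          Multiset.singleton_add]
      · congr 1
        ext <;> simp

/-- The sum over the first `m` indices. -/
noncomputable def partialSum {k : ℕ} (x : Fin k → ℝ) (m : ℕ) : ℝ :=
  ∑ i : Fin k, if (i : ℕ) < m then x i else 0

theorem partialSum_succ {k : ℕ} (x : Fin (k + 1) → ℝ) (m : ℕ) :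
    partialSum x (m + 1) = x 0 + partialSum (Fin.tail x) m := by
  simp [partialSum, Fin.sum_univ_succ, Fin.tail]

theorem partialSum_zero {k : ℕ} (x : Fin k → ℝ) : partialSum x 0 = 0 := by
  simp [partialSum]

theorem partialSum_nonneg {k : ℕ} {x : Fin k → ℝ} (hx : ∀ i, 0 ≤ x i) (m : ℕ) :
    0 ≤ partialSum x m := by
  refine Finset.sum_nonneg fun i _ => ?_
  split_ifs
  · exact hx i
  · exact le_rfl

/-- Cut a sorted list of levels into consecutive blocks of prescribed weights, and merge each
block. The populations of the blocks dominate the Lorenz curve of the list. -/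
theorem exists_blocks {k : ℕ} (w : Fin k → ℝ) (hw : ∀ i, 0 < w i) (l : List (ℝ × ℝ))
    (hl : DensitySorted l) (hlw : (l.map Prod.snd).sum = ∑ i, w i) :
    ∃ (y : Fin k → ℝ) (z : ℕ),
      Flows ((l : Multiset (ℝ × ℝ)) + Multiset.replicate k 0)
        (Finset.univ.val.map (fun i => (y i, w i)) + Multiset.replicate z 0) ∧
      (∀ m, 0 < m → ∃ c, c * partialSum w m + excess c l ≤ partialSum y m) ∧
      ∑ i, y i = (l.map Prod.fst).sum := by
  induction k generalizing l with
  | zero =>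
    have : l = [] := by
      cases l with
      | nil => rfl
      | cons v l =>
        have h1 := hl.1 v List.mem_cons_self
        have h2 := hl.tail.weight_nonneg
        simp at hlw
        linarith
    subst this
    refine ⟨Fin.elim0, 0, ?_, fun m _ => ⟨0, ?_⟩, by simp⟩
    · simpa using Flows.refl _
    · simp [excess, partialSum]
  | succ k ih =>
    rw [Fin.sum_univ_succ] at hlw
    obtain ⟨l', y₀, c₀, z, hcut, hflow⟩ := exists_cut l hl (hw 0) (by
      rw [hlw]
      exact le_add_of_nonneg_right (Finset.sum_nonneg fun i _ => (hw _).le))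
    obtain ⟨y, z', hflow', hy, hysum⟩ := ih (Fin.tail w) (fun i => hw _) l' hcut.sorted (by
      have := hcut.weight
      rw [hlw] at this
      exact (add_left_cancel this).symm)
    refine ⟨Fin.cons y₀ y, z + z', ?_, ?_, ?_⟩
    · have h1 := hflow.add_right (Multiset.replicate k 0)
      have h2 := hflow'.add_right ((y₀, w 0) ::ₘ Multiset.replicate z 0)
      convert h1.trans (R := Finset.univ.val.map (fun i => (y i, Fin.tail w i)) +
        Multiset.replicate z' 0 + ((y₀, w 0) ::ₘ Multiset.replicate z 0)) ?_ using 1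
      · rw [Multiset.replicate_succ, ← Multiset.singleton_add, add_assoc]
      · rw [Fin.univ_val_map, Fin.univ_val_map, List.ofFn_succ, ← Multiset.cons_coe,
          Multiset.replicate_add, ← Multiset.singleton_add, ← Multiset.singleton_add]
        simp only [Fin.cons_zero, Fin.cons_succ, Fin.tail]
        abel
      · convert h2 using 1
        rw [← Multiset.singleton_add, ← Multiset.singleton_add]
        abel
    · intro m hm
      obtain ⟨m, rfl⟩ : ∃ m', m = m' + 1 := ⟨m - 1, by omega⟩
      rw [partialSum_succ, partialSum_succ]
      simp only [Fin.cons_zero, Fin.tail_cons]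
      rcases Nat.eq_zero_or_pos m with rfl | hm
      · refine ⟨c₀, ?_⟩
        rw [partialSum_zero, partialSum_zero, add_zero, add_zero]
        exact hcut.eq.ge
      · obtain ⟨c, hc⟩ := hy m hm
        have hW : 0 ≤ partialSum (Fin.tail w) m := partialSum_nonneg (fun i => (hw _).le) m
        -- The smaller of the two slopes works. Below `c₀` the excess of `l` is an exact sum;
        -- otherwise `l'` has no excess over `c₀`, and lowering `c` to `c₀` only lowers `c *
        -- partialSum`.
        rcases le_total c c₀ with hcc | hcc
        · refine ⟨c, ?_⟩
          rw [hcut.excess_eq c hcc]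
          linarith
        · refine ⟨c₀, ?_⟩
          rw [hcut.excess_eq c₀ le_rfl, excess_eq_zero hcut.le]
          have h0 : 0 ≤ excess c l' := by
            refine List.sum_nonneg fun x hx => ?_
            obtain ⟨v, _, rfl⟩ := List.mem_map.1 hx
            exact le_max_right _ _
          nlinarith [mul_le_mul_of_nonneg_right hcc hW]
    · rw [Fin.sum_univ_succ, hcut.population]
      simp [hysum]

end CoarseThermo

namespace CoarseThermo

open Relation

/-! ### Majorization -/

/-- The remainder `S` is common to all `f`, so a change at `i` and `j` becomes a move on two
elements of a multiset. -/
theorem exists_map_univ_eq_cons_cons {ι α : Type*} [Fintype ι] [DecidableEq ι] {i j : ι}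
    (hij : i ≠ j) (s : ι → α) :
    ∃ S : Multiset α, ∀ f : ι → α, (∀ k, k ≠ i → k ≠ j → f k = s k) →
      Finset.univ.val.map f = f i ::ₘ f j ::ₘ S := by
  refine ⟨((Finset.univ.erase i).erase j).val.map s, fun f hf => ?_⟩
  have hj : j ∈ Finset.univ.erase i := Finset.mem_erase.2 ⟨hij.symm, Finset.mem_univ _⟩
  have h1 : (Finset.univ : Finset ι).val = i ::ₘ j ::ₘ ((Finset.univ.erase i).erase j).val := by
    rw [← Finset.insert_val_of_notMem (Finset.notMem_erase j _), Finset.insert_erase hj,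
      ← Finset.insert_val_of_notMem (Finset.notMem_erase i _),
      Finset.insert_erase (Finset.mem_univ i)]
  rw [h1, Multiset.map_cons, Multiset.map_cons]
  congr 2
  refine Multiset.map_congr rfl fun k hk => ?_
  have hk' : k ∈ (Finset.univ.erase i).erase j := hk
  rw [Finset.mem_erase, Finset.mem_erase] at hk'
  exact hf k hk'.2.1 hk'.1

/-- If the weights agree, `q` has decreasing densities and the partial sums of `y` dominate those
of `q`, then `y` can be turned into `q` by transfers from denser to less dense levels. -/
theorem Flows.of_partialSum_le {k : ℕ} {w q : Fin k → ℝ} (hw : ∀ i, 0 < w i)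
    (hq : ∀ i j, i ≤ j → q j * w i ≤ q i * w j) (y : Fin k → ℝ)
    (hle : ∀ m, partialSum q m ≤ partialSum y m) (hsum : ∑ i, y i = ∑ i, q i) :
    Flows (Finset.univ.val.map fun i => (y i, w i)) (Finset.univ.val.map fun i => (q i, w i)) := by
  induction hN : (Finset.univ.filter fun i => y i ≠ q i).card using Nat.strong_induction_on
    generalizing y with
  | _ N ih =>
    by_cases hdef : ∃ i, y i < q i
    swap
    · push Not at hdef
      have : ∀ i ∈ Finset.univ, q i = y i :=
        (Finset.sum_eq_sum_iff_of_le fun i _ => hdef i).1 hsum.symm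
      have : q = y := funext fun i => this i (Finset.mem_univ i)
      rw [this]
      exact .refl _
    -- Take the first deficit `r`. Domination of the partial sums through `r` forces a surplus at
    -- some earlier `j`.
    obtain ⟨r, hr, hrmin⟩ : ∃ r, y r < q r ∧ ∀ i, i < r → q i ≤ y i := by
      have hne : (Finset.univ.filter fun i => y i < q i).Nonempty := by
        obtain ⟨i, hi⟩ := hdef
        exact ⟨i, by simpa using hi⟩
      refine ⟨Finset.min' _ hne, (Finset.mem_filter.1 (Finset.min'_mem _ hne)).2, fun i hi => ?_⟩
      by_contra hlt
      rw [not_le] at hlt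
      exact absurd (Finset.min'_le _ i (by simpa using hlt)) (not_le.2 hi)
    obtain ⟨j, hjr, hj⟩ : ∃ j, j < r ∧ q j < y j := by
      by_contra hno
      push Not at hno
      refine absurd (hle (r + 1)) (not_le.2 ?_)
      refine Finset.sum_lt_sum (fun i _ => ?_) ⟨r, Finset.mem_univ r, by simpa using hr⟩
      split_ifs with hi
      · rcases (Nat.lt_succ_iff.1 hi).lt_or_eq with h | h
        · exact hno i h
        · rw [Fin.ext h]
          exact hr.le
      · exact le_rfl
    have hjr' : j ≠ r := hjr.ne
    -- The largest transfer that overshoots neither target. It settles `j` or `r`, so the number of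
    -- wrong entries drops.
    set δ := min (y j - q j) (q r - y r) with hδ
    have hδ0 : 0 < δ := lt_min (by linarith) (by linarith)
    have hδ1 : δ ≤ y j - q j := min_le_left _ _
    have hδ2 : δ ≤ q r - y r := min_le_right _ _
    set y' := setPair j r (y j - δ) (y r + δ) y with hy'
    have hy'j : y' j = y j - δ := setPair_left hjr' _ _ _
    have hy'r : y' r = y r + δ := setPair_right _ _ _ _ _
    have hy'k : ∀ i, i ≠ j → i ≠ r → y' i = y i := fun i h1 h2 => setPair_of_ne h1 h2 _ _ _
    have hstep : Flows (Finset.univ.val.map fun i => (y i, w i))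
        (Finset.univ.val.map fun i => (y' i, w i)) := by
      obtain ⟨S, hS⟩ := exists_map_univ_eq_cons_cons hjr' fun i => (y i, w i)
      rw [hS _ fun _ _ _ => rfl, hS (fun i => (y' i, w i)) fun i h1 h2 => by rw [hy'k i h1 h2],
        hy'j, hy'r]
      refine Flows.transfer (hw j) (hw r) hδ0.le ?_ S
      -- After the transfer `r` is still at most at its target and `j` at least at its own; the
      -- ordered target densities make the move downhill.
      calc (y r + δ) * w j ≤ q r * w j := by gcongr; exacts [(hw j).le, by linarith]
        _ ≤ q j * w r := hq j r hjr.le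
        _ ≤ (y j - δ) * w r := by gcongr; exacts [(hw r).le, by linarith]
    refine hstep.trans (ih _ ?_ y' ?_ ?_ rfl)
    · rw [← hN]
      refine Finset.card_lt_card (Finset.ssubset_iff_of_subset ?_ |>.2 ?_)
      · intro i hi
        rw [Finset.mem_filter] at hi ⊢
        refine ⟨hi.1, ?_⟩
        by_cases h1 : i = j
        · rw [h1]
          exact hj.ne'
        · by_cases h2 : i = r
          · rw [h2]
            exact hr.ne
          · rw [← hy'k i h1 h2]
            exact hi.2
      · rcases min_choice (y j - q j) (q r - y r) with h | h
        · refine ⟨j, by simpa using hj.ne', ?_⟩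
          rw [← hδ] at h
          simp [hy'j, h]
        · refine ⟨r, by simpa using hr.ne, ?_⟩
          rw [← hδ] at h
          simp [hy'r, h]
    -- Sums reaching past `r` do not change; shorter ones dominate term by term, because `r` is the
    -- first deficit.
    · intro m
      by_cases hm : (r : ℕ) < m
      · refine (hle m).trans_eq ?_
        rw [eq_comm, ← sub_eq_zero, partialSum, partialSum, ← Finset.sum_sub_distrib,
          Fintype.sum_eq_add j r hjr']
        · have hjm : (j : ℕ) < m := lt_trans (Fin.lt_def.1 hjr) hm
          rw [if_pos hm, if_pos hm, if_pos hjm, if_pos hjm, hy'j, hy'r]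
          ring
        · rintro i ⟨h1, h2⟩
          rw [hy'k i h1 h2, sub_self]
      · refine Finset.sum_le_sum fun i _ => ?_
        split_ifs with hi
        · have hir : i < r := Fin.lt_def.2 (by omega)
          by_cases h1 : i = j
          · rw [h1, hy'j]
            linarith
          · rw [hy'k i h1 hir.ne]
            exact hrmin i hir
        · exact le_rfl
    · rw [← hsum, ← sub_eq_zero, ← Finset.sum_sub_distrib, Fintype.sum_eq_add j r hjr']
      · rw [hy'j, hy'r]
        ring
      · rintro i ⟨h1, h2⟩
        rw [hy'k i h1 h2, sub_self]

theorem exists_perm_density_antitone {n : ℕ} {w : Fin n → ℝ} (hw : ∀ i, 0 < w i)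
    (p : Fin n → ℝ) :
    ∃ π : Equiv.Perm (Fin n), ∀ i j, i ≤ j → p (π j) * w (π i) ≤ p (π i) * w (π j) := by
  refine ⟨Tuple.sort fun i => -(p i / w i), fun i j hij => ?_⟩
  have := Tuple.monotone_sort (fun i => -(p i / w i)) hij
  simp only [Function.comp_apply, neg_le_neg_iff] at this
  rwa [div_le_div_iff₀ (hw _) (hw _)] at this

theorem map_univ_comp_perm {ι α : Type*} [Fintype ι] (f : ι → α) (π : Equiv.Perm ι) :
    Finset.univ.val.map (fun i => f (π i)) = Finset.univ.val.map f := by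
  have h : (Finset.univ.map π.toEmbedding).val.map f = Finset.univ.val.map f := by
    rw [Finset.map_univ_equiv]
  rw [← h, Finset.map_val, Multiset.map_map]
  rfl

theorem exists_perm_of_map_univ_eq {ι α : Type*} [Fintype ι] {f g : ι → α}
    (h : Finset.univ.val.map f = Finset.univ.val.map g) :
    ∃ π : Equiv.Perm ι, g = f ∘ π := by
  classical
  have hcard : ∀ c, Nonempty ({a // g a = c} ≃ {a // f a = c}) := by
    intro c
    rw [← Fintype.card_eq, Fintype.card_subtype, Fintype.card_subtype]
    have := congrArg (Multiset.count c) h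
    rw [Multiset.count_map, Multiset.count_map] at this
    simp only [eq_comm (a := c)] at this
    exact this.symm
  exact ⟨Equiv.ofFiberEquiv fun c => (hcard c).some,
    funext fun i => (Equiv.ofFiberEquiv_map _ i).symm⟩

/-- Thermo-majorization implies convertibility, given one spare vector per level. -/
theorem Flows.of_thermoMajorization {n : ℕ} {w : Fin n → ℝ} (hw : ∀ i, 0 < w i)
    (p q : Fin n → ℝ) (hsum : ∑ i, p i = ∑ i, q i)
    (h : ∀ c, ∑ i, max (q i - c * w i) 0 ≤ ∑ i, max (p i - c * w i) 0) :
    Flows (Finset.univ.val.map (fun i => (p i, w i)) + Multiset.replicate n 0)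
      (Finset.univ.val.map (fun i => (q i, w i)) + Multiset.replicate n 0) := by
  obtain ⟨π, hπ⟩ := exists_perm_density_antitone hw p
  obtain ⟨τ, hτ⟩ := exists_perm_density_antitone hw q
  set l : List (ℝ × ℝ) := List.ofFn fun i => (p (π i), w (π i)) with hl
  have hcoe : (l : Multiset (ℝ × ℝ)) = Finset.univ.val.map fun i => (p i, w i) := by
    rw [hl, ← Fin.univ_val_map]
    exact map_univ_comp_perm (fun i => (p i, w i)) π
  have hlsum : ∀ f : ℝ × ℝ → ℝ, (l.map f).sum = ∑ i, f (p i, w i) := by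
    intro f
    rw [hl, List.map_ofFn, List.sum_ofFn]
    exact Equiv.sum_comp π fun i => f (p i, w i)
  have hsorted : DensitySorted l := by
    refine ⟨fun v hv => ?_, ?_⟩
    · obtain ⟨i, rfl⟩ := (List.mem_ofFn' _ _).1 hv
      exact hw _
    · rw [hl, List.pairwise_ofFn]
      exact fun i j hij => hπ i j hij.le
  -- The blocks get the weights of the levels in the density order `τ` of the target, not of the
  -- source.
  obtain ⟨y, z, hflow, hy, hysum⟩ := exists_blocks (fun i => w (τ i)) (fun i => hw _) l hsorted (by
    rw [hlsum Prod.snd, Equiv.sum_comp τ])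
  have hz : z = n := by
    have := hflow.card_eq
    rw [hcoe] at this
    simpa using this
  rw [hcoe, hz] at hflow
  refine hflow.trans ?_
  rw [← map_univ_comp_perm (fun i => (q i, w i)) τ]
  refine Flows.add_right ?_ _
  refine Flows.of_partialSum_le (fun i => hw _) hτ y (fun m => ?_) ?_
  · rcases Nat.eq_zero_or_pos m with rfl | hm
    · rw [partialSum_zero, partialSum_zero]
    · obtain ⟨c, hc⟩ := hy m hm
      refine le_trans ?_ hc
      have h1 : ∑ i, max (q i - c * w i) 0 ≤ excess c l := 
        (h c).trans_eq (hlsum fun v => max (v.1 - c * v.2) 0).symm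
      have h2 : partialSum (fun i => q (τ i)) m - c * partialSum (fun i => w (τ i)) m ≤
          ∑ i, max (q i - c * w i) 0 := by
        rw [← Equiv.sum_comp τ, partialSum, partialSum, Finset.mul_sum, ← Finset.sum_sub_distrib]
        refine Finset.sum_le_sum fun i _ => ?_
        split_ifs
        · exact le_max_left _ _
        · simp
      linarith
  · rw [hysum, hlsum Prod.fst, hsum, Equiv.sum_comp τ]

/-! ### From multisets back to levels -/

variable {ι : Type} [Fintype ι] [DecidableEq ι]
variable {β : ℝ} {𝒰 : Set (Matrix ι ι ℂ)} {C : Config ι} {s : ι → ℝ × ℝ}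

theorem exists_of_map_univ_eq_cons_cons {α : Type*} [DecidableEq α] {s : ι → α} {u v : α}
    {S : Multiset α} (h : Finset.univ.val.map s = u ::ₘ v ::ₘ S) :
    ∃ i j, i ≠ j ∧ s i = u ∧ s j = v ∧
      ∀ u' v', Finset.univ.val.map (setPair i j u' v' s) = u' ::ₘ v' ::ₘ S := by
  obtain ⟨i, hi, hiu, h1⟩ := (Multiset.map_eq_cons s _ _ u).2 h
  obtain ⟨j, hj, hjv, h2⟩ := (Multiset.map_eq_cons s _ _ v).2 h1
  have hij : i ≠ j := by
    rintro rfl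
    exact (Multiset.Nodup.notMem_erase Finset.univ.nodup) hj
  refine ⟨i, j, hij, hiu, hjv, fun u' v' => ?_⟩
  obtain ⟨T, hT⟩ := exists_map_univ_eq_cons_cons hij s
  have hTS : T = S := by
    have := hT s fun _ _ _ => rfl
    rw [h, hiu, hjv] at this
    simpa using this.symm
  rw [hT _ fun k h1 h2 => setPair_of_ne h1 h2 _ _ _, setPair_left hij, setPair_right, hTS]

theorem Attainable.exists_of_flows (hβ : 0 < β) (hs : Attainable β 𝒰 C s)
    {T : Multiset (ℝ × ℝ)} (h : Flows (Finset.univ.val.map s) T) :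
    ∃ s', Attainable β 𝒰 C s' ∧ Finset.univ.val.map s' = T := by
  induction h with
  | refl => exact ⟨s, hs, rfl⟩
  | tail _ hstep ih =>
    obtain ⟨t, ht, htm⟩ := ih
    cases hstep with
    | rebalance u v S θ h0 h1 =>
      obtain ⟨i, j, hij, rfl, rfl, hS⟩ := exists_of_map_univ_eq_cons_cons htm
      exact ⟨_, ht.rebalance hβ hij h0 h1, hS _ _⟩
    | mix u v S lam h0 h1 hw =>
      obtain ⟨i, j, hij, rfl, rfl, hS⟩ := exists_of_map_univ_eq_cons_cons htm
      exact ⟨_, ht.partialMix hij h0 h1 hw, hS _ _⟩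

/-- Rebalancing with `θ = 0` pushes the whole vector of `i` into the empty level `z`. -/
theorem Attainable.swap_zero (hβ : 0 < β) (hs : Attainable β 𝒰 C s) (i : ι) {z : ι}
    (hz : s z = 0) : Attainable β 𝒰 C (s ∘ Equiv.swap i z) := by
  by_cases hiz : i = z
  · subst hiz
    simpa using hs
  · have := hs.rebalance hβ hiz le_rfl zero_le_one
    convert this using 1
    refine eq_setPair ?_ ?_ fun k h1 h2 => ?_
    · simp [hz]
    · simp [hz]
    · simp [Equiv.swap_apply_of_ne_of_ne h1 h2]

/-- Three moves through the empty level, used as temporary storage. -/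
theorem Attainable.swap (hβ : 0 < β) (hs : Attainable β 𝒰 C s) (hz : ∃ z, s z = 0) (i j : ι) :
    Attainable β 𝒰 C (s ∘ Equiv.swap i j) := by
  obtain ⟨z, hz⟩ := hz
  by_cases hij : i = j
  · subst hij
    simpa using hs
  by_cases hiz : i = z
  · subst hiz
    rw [Equiv.swap_comm]
    exact hs.swap_zero hβ j hz
  by_cases hjz : j = z
  · subst hjz
    exact hs.swap_zero hβ i hz
  have h1 := hs.swap_zero hβ i hz
  have h2 := h1.swap_zero hβ j (z := i) (by simp [hz])
  have h3 := h2.swap_zero hβ z (z := j) (by simp [hz])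
  convert h3 using 1
  funext k
  simp only [Function.comp_apply]
  congr 1
  simp only [Equiv.swap_apply_def]
  split_ifs <;> simp_all

theorem Attainable.comp_perm (hβ : 0 < β) (hs : Attainable β 𝒰 C s) (hz : ∃ z, s z = 0)
    (π : Equiv.Perm ι) : Attainable β 𝒰 C (s ∘ π) := by
  induction π using Equiv.Perm.swap_induction_on' with
  | one => simpa using hs
  | mul_swap π i j _ ih =>
    obtain ⟨z, hz⟩ := hz
    exact ih.swap hβ ⟨π.symm z, by simp [hz]⟩ i j

/-- A flow fixes the vectors but not their positions; the empty level supplies the missing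
permutation. -/
theorem Attainable.of_flows (hβ : 0 < β) (hs : Attainable β 𝒰 C s) {s' : ι → ℝ × ℝ}
    (h : Flows (Finset.univ.val.map s) (Finset.univ.val.map s')) (hz : ∃ z, s' z = 0) :
    Attainable β 𝒰 C s' := by
  obtain ⟨t, ht, htm⟩ := hs.exists_of_flows hβ h
  obtain ⟨π, rfl⟩ := exists_perm_of_map_univ_eq htm
  obtain ⟨z, hz⟩ := hz
  exact ht.comp_perm hβ ⟨π z, hz⟩ π

/-! ### Splitting and merging the two copies of each level -/

/-- With `θ = 1` this empties all levels with the ancilla in state 1, which yields the spare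
vectors; with `θ` the Gibbs probability of ancilla state 0 it restores a thermal ancilla. -/
theorem Attainable.rebalance_fibers {β : ℝ} {𝒰 : Set (Matrix (ι × Fin 2) (ι × Fin 2) ℂ)}
    {C : Config (ι × Fin 2)} {s : ι × Fin 2 → ℝ × ℝ} (hβ : 0 < β) (hs : Attainable β 𝒰 C s)
    {θ : ℝ} (h0 : 0 ≤ θ) (h1 : θ ≤ 1) :
    Attainable β 𝒰 C fun x => (if x.2 = 0 then θ else 1 - θ) • (s (x.1, 0) + s (x.1, 1)) := by
  have key : ∀ T : Finset ι, Attainable β 𝒰 C fun x =>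
      if x.1 ∈ T then (if x.2 = 0 then θ else 1 - θ) • (s (x.1, 0) + s (x.1, 1)) else s x := by
    intro T
    induction T using Finset.induction_on with
    | empty => simpa using hs
    | insert i T hi ih =>
      have hne : ((i, 0) : ι × Fin 2) ≠ (i, 1) := by simp
      have := ih.rebalance hβ hne h0 h1
      convert this using 1
      refine eq_setPair ?_ ?_ ?_
      · simp [hi]
      · simp [hi]
      · rintro ⟨k, t⟩ hk0 hk1
        have hki : k ≠ i := by
          rintro rfl
          fin_cases t <;> simp_all
        simp [hki]
  simpa using key Finset.univ

end CoarseThermo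

namespace CoarseThermo

/-! ### Energy-conserving unitaries -/

section Unitaries

variable {ι κ : Type} [Fintype ι] [DecidableEq ι] [Fintype κ] [DecidableEq κ]

theorem commute_hamiltonian_iff {E : ι → ℝ} {U : Matrix ι ι ℂ} :
    Commute U (hamiltonian E) ↔ ∀ i j, E i ≠ E j → U i j = 0 := by
  constructor
  · intro h i j hij
    have := congrFun (congrFun h.eq i) j
    rw [hamiltonian, Matrix.mul_diagonal, Matrix.diagonal_mul, mul_comm, ← sub_eq_zero,
      ← sub_mul, mul_eq_zero, sub_eq_zero] at this
    exact this.resolve_left fun h' => hij (by exact_mod_cast h'.symm)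
  · intro h
    refine Matrix.ext fun i j => ?_
    rw [hamiltonian, Matrix.mul_diagonal, Matrix.diagonal_mul]
    by_cases hij : E i = E j
    · rw [hij, mul_comm]
    · simp [h i j hij]

theorem commute_conjTranspose_hamiltonian {E : ι → ℝ} {U : Matrix ι ι ℂ}
    (h : Commute U (hamiltonian E)) : Commute U.conjTranspose (hamiltonian E) := by
  rw [commute_hamiltonian_iff] at h ⊢
  intro i j hij
  rw [Matrix.conjTranspose_apply, h j i hij.symm, star_zero]

theorem conjTranspose_mem_unitaryGroup {U : Matrix ι ι ℂ} (h : U ∈ Matrix.unitaryGroup ι ℂ) :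
    U.conjTranspose ∈ Matrix.unitaryGroup ι ℂ :=
  Unitary.star_mem h

theorem mul_conjTranspose_self_of_unitary {U : Matrix ι ι ℂ} (h : U ∈ Matrix.unitaryGroup ι ℂ) :
    U * U.conjTranspose = 1 :=
  Matrix.mem_unitaryGroup_iff.1 h

theorem conjTranspose_mul_self_of_unitary {U : Matrix ι ι ℂ} (h : U ∈ Matrix.unitaryGroup ι ℂ) :
    U.conjTranspose * U = 1 :=
  Matrix.mem_unitaryGroup_iff'.1 h

theorem trace_unitary_conj {U : Matrix ι ι ℂ} (h : U ∈ Matrix.unitaryGroup ι ℂ)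
    (A : Matrix ι ι ℂ) : (U * A * U.conjTranspose).trace = A.trace := by
  rw [Matrix.trace_mul_comm, ← mul_assoc, conjTranspose_mul_self_of_unitary h, one_mul]

/-- The block matrix with blocks indexed by the energies. -/
noncomputable def energyBlocks (E : ι → ℝ)
    (U : ∀ e : ℝ, Matrix {i // E i = e} {i // E i = e} ℂ) : Matrix ι ι ℂ :=
  Matrix.of fun i k => if h : E k = E i then U (E i) ⟨i, rfl⟩ ⟨k, h⟩ else 0

theorem sum_energyBlocks_mul (E : ι → ℝ) (U : ∀ e : ℝ, Matrix {i // E i = e} {i // E i = e} ℂ)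
    {e : ℝ} (i : {i // E i = e}) (X : ι → ℂ) :
    ∑ k, energyBlocks E U i k * X k = ∑ k : {i // E i = e}, U e i k * X k := by
  obtain ⟨i, rfl⟩ := i
  rw [← Finset.sum_subtype (Finset.univ.filter fun k => E k = E i) (by simp)
    (fun k => energyBlocks E U i k * X k) |>.trans (Finset.sum_congr rfl fun k _ => ?_)]
  · rw [Finset.sum_filter_of_ne]
    intro k _ hk
    by_contra hne
    exact hk (by simp [energyBlocks, hne])
  · simp [energyBlocks, k.2]

/-- Diagonalise the compression of `A` to each energy eigenspace and assemble the unitaries into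
blocks. Coherences between different energies need not disappear. -/
theorem exists_unitary_diagonal_on_blocks (E : ι → ℝ) {A : Matrix ι ι ℂ} (hA : A.IsHermitian) :
    ∃ V ∈ Matrix.unitaryGroup ι ℂ, Commute V (hamiltonian E) ∧
      ∀ i j, i ≠ j → E i = E j → (V * A * V.conjTranspose) i j = 0 := by
  have hsub : ∀ e, (A.submatrix (Subtype.val : {i // E i = e} → ι) Subtype.val).IsHermitian :=
    fun e => hA.submatrix _
  set U : ∀ e : ℝ, Matrix {i // E i = e} {i // E i = e} ℂ := fun e =>
    star ((hsub e).eigenvectorUnitary : Matrix {i // E i = e} {i // E i = e} ℂ) with hU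
  have hUU : ∀ e, U e * (U e).conjTranspose = 1 := fun e =>
    mul_conjTranspose_self_of_unitary (Unitary.star_mem (hsub e).eigenvectorUnitary.2)
  have hUA : ∀ e, U e * A.submatrix Subtype.val Subtype.val * (U e).conjTranspose =
      Matrix.diagonal (RCLike.ofReal ∘ (hsub e).eigenvalues) := by
    intro e
    have := (hsub e).conjStarAlgAut_star_eigenvectorUnitary
    rw [Unitary.conjStarAlgAut_apply] at this
    simpa [hU, Matrix.star_eq_conjTranspose] using this
  set V := energyBlocks E U with hV
  have hVU : ∀ e, ∀ i j : {i // E i = e}, ∀ X : Matrix ι ι ℂ, (V * X * V.conjTranspose) i j =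
      (U e * X.submatrix (Subtype.val : {i // E i = e} → ι) Subtype.val *
        (U e).conjTranspose : Matrix {i // E i = e} {i // E i = e} ℂ) i j := by
    intro e i j X
    have h1 : ∀ l, (V * X) i l = ∑ k : {i // E i = e}, U e i k * X k l := fun l =>
      sum_energyBlocks_mul E U i fun k => X k l
    have h2 : (V * X * V.conjTranspose) i j = star (∑ l, V j l * star ((V * X) i l)) := by
      rw [Matrix.mul_apply, star_sum]
      exact Finset.sum_congr rfl fun l _ => by
        rw [Matrix.conjTranspose_apply, star_mul, star_star]
    rw [h2, sum_energyBlocks_mul, star_sum, Matrix.mul_apply]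
    refine Finset.sum_congr rfl fun l _ => ?_
    rw [star_mul, star_star, h1, Matrix.conjTranspose_apply, Matrix.mul_apply]
    rfl
  have hoff : ∀ i j, E i ≠ E j → V i j = 0 := by
    intro i j hij
    simp [hV, energyBlocks, hij.symm]
  refine ⟨V, ?_, commute_hamiltonian_iff.2 hoff, ?_⟩
  · rw [Matrix.mem_unitaryGroup_iff, Matrix.star_eq_conjTranspose]
    refine Matrix.ext fun i j => ?_
    by_cases hij : E i = E j
    · have := hVU (E j) ⟨i, hij⟩ ⟨j, rfl⟩ 1
      rw [mul_one, Matrix.submatrix_one _ Subtype.val_injective, mul_one, hUU] at this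
      rw [this, Matrix.one_apply, Matrix.one_apply]
      simp
    · rw [Matrix.one_apply_ne (fun h => hij (congrArg E h)), Matrix.mul_apply]
      refine Finset.sum_eq_zero fun k _ => ?_
      by_cases hik : E i = E k
      · rw [Matrix.conjTranspose_apply, hoff j k (fun h => hij (hik.trans h.symm)), star_zero,
          mul_zero]
      · rw [hoff i k hik, zero_mul]
  · intro i j hne hij
    have := hVU (E j) ⟨i, hij⟩ ⟨j, rfl⟩ A
    rw [this, hUA, Matrix.diagonal_apply_ne]
    simpa using hne

/-! ### Thermal operations act on populations by Gibbs-preserving stochastic matrices -/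

theorem kronecker_one_mul_apply (W : Matrix ι ι ℂ) (X : Matrix (ι × κ) (ι × κ) ℂ) (i : ι) (s : κ)
    (y : ι × κ) : ((W ⊗ₖ (1 : Matrix κ κ ℂ)) * X) (i, s) y = ∑ k, W i k * X (k, s) y := by
  rw [Matrix.mul_apply, Fintype.sum_prod_type]
  refine Finset.sum_congr rfl fun k _ => ?_
  rw [Finset.sum_eq_single s]
  · simp
  · intro t _ ht
    simp [Matrix.one_apply_ne ht.symm]
  · simp

theorem mul_kronecker_one_apply (W : Matrix ι ι ℂ) (X : Matrix (ι × κ) (ι × κ) ℂ) (x : ι × κ)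
    (j : ι) (s : κ) : (X * (W ⊗ₖ (1 : Matrix κ κ ℂ))) x (j, s) = ∑ k, X x (k, s) * W k j := by
  rw [Matrix.mul_apply, Fintype.sum_prod_type]
  refine Finset.sum_congr rfl fun k _ => ?_
  rw [Finset.sum_eq_single s]
  · simp
  · intro t _ ht
    simp [Matrix.one_apply_ne ht]
  · simp

theorem traceOut_conj_kronecker_one (W W' : Matrix ι ι ℂ) (X : Matrix (ι × κ) (ι × κ) ℂ) :
    traceOut ((W ⊗ₖ (1 : Matrix κ κ ℂ)) * X * (W' ⊗ₖ (1 : Matrix κ κ ℂ))) =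
      W * traceOut X * W' := by
  refine Matrix.ext fun i j => ?_
  simp only [traceOut, Matrix.of_apply, Matrix.mul_apply (M := W * _), mul_kronecker_one_apply,
    kronecker_one_mul_apply]
  rw [Finset.sum_comm]
  refine Finset.sum_congr rfl fun k _ => ?_
  rw [Matrix.mul_apply, ← Finset.sum_mul, Finset.sum_comm]
  simp only [Matrix.of_apply, Finset.mul_sum]

theorem kronecker_one_mem_unitaryGroup {W : Matrix ι ι ℂ} (h : W ∈ Matrix.unitaryGroup ι ℂ) :
    W ⊗ₖ (1 : Matrix κ κ ℂ) ∈ Matrix.unitaryGroup (ι × κ) ℂ := by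
  rw [Matrix.mem_unitaryGroup_iff, Matrix.star_eq_conjTranspose, Matrix.conjTranspose_kronecker,
    ← Matrix.mul_kronecker_mul, mul_conjTranspose_self_of_unitary h]
  simp

theorem commute_kronecker_one_hamiltonian {W : Matrix ι ι ℂ} {E : ι → ℝ} (B : κ → ℝ)
    (h : Commute W (hamiltonian E)) :
    Commute (W ⊗ₖ (1 : Matrix κ κ ℂ)) (hamiltonian fun x : ι × κ => E x.1 + B x.2) := by
  rw [commute_hamiltonian_iff] at h ⊢
  rintro ⟨i, s⟩ ⟨j, t⟩ hne
  rw [Matrix.kroneckerMap_apply]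
  by_cases hst : s = t
  · subst hst
    rw [h i j fun h' => hne (by simp [h']), zero_mul]
  · rw [Matrix.one_apply_ne hst, mul_zero]

/-- Transition probabilities between levels induced by a unitary on system and bath. -/
noncomputable def transition {m : ℕ} (β : ℝ) (B : Fin m → ℝ)
    (U : Matrix (ι × Fin m) (ι × Fin m) ℂ) (i j : ι) : ℝ :=
  ∑ s, ∑ t, Complex.normSq (U (i, s) (j, t)) *
    (Real.exp (-β * B t) / ∑ u, Real.exp (-β * B u))

theorem transition_nonneg {m : ℕ} (β : ℝ) (B : Fin m → ℝ)
    (U : Matrix (ι × Fin m) (ι × Fin m) ℂ) (i j : ι) : 0 ≤ transition β B U i j :=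
  Finset.sum_nonneg fun _ _ => Finset.sum_nonneg fun _ _ => mul_nonneg (Complex.normSq_nonneg _)
    (div_nonneg (Real.exp_pos _).le (Finset.sum_nonneg fun _ _ => (Real.exp_pos _).le))

theorem sum_normSq_row {U : Matrix ι ι ℂ} (hU : U ∈ Matrix.unitaryGroup ι ℂ) (i : ι) :
    ∑ j, Complex.normSq (U i j) = 1 := by
  have := congrFun (congrFun (mul_conjTranspose_self_of_unitary hU) i) i
  rw [Matrix.mul_apply, Matrix.one_apply_eq] at this
  have h2 : ∀ j, U i j * U.conjTranspose j i = (Complex.normSq (U i j) : ℂ) := fun j => by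
    rw [Matrix.conjTranspose_apply, Complex.star_def, Complex.mul_conj]
  simp only [h2] at this
  exact_mod_cast this

theorem sum_normSq_col {U : Matrix ι ι ℂ} (hU : U ∈ Matrix.unitaryGroup ι ℂ) (j : ι) :
    ∑ i, Complex.normSq (U i j) = 1 := by
  have := sum_normSq_row (conjTranspose_mem_unitaryGroup hU) j
  simpa [Matrix.conjTranspose_apply, Complex.star_def, Complex.normSq_conj] using this

theorem sum_exp_pos {m : ℕ} (hm : 0 < m) (β : ℝ) (B : Fin m → ℝ) :
    0 < ∑ u, Real.exp (-β * B u) :=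
  Finset.sum_pos (fun _ _ => Real.exp_pos _) ⟨⟨0, hm⟩, Finset.mem_univ _⟩

theorem sum_transition {m : ℕ} (hm : 0 < m) (β : ℝ) (B : Fin m → ℝ)
    {U : Matrix (ι × Fin m) (ι × Fin m) ℂ} (hU : U ∈ Matrix.unitaryGroup (ι × Fin m) ℂ) (j : ι) :
    ∑ i, transition β B U i j = 1 := by
  have hZ := sum_exp_pos hm β B
  unfold transition
  rw [← Fintype.sum_prod_type' (f := fun i s => ∑ t, Complex.normSq (U (i, s) (j, t)) *
    (Real.exp (-β * B t) / ∑ u, Real.exp (-β * B u))), Finset.sum_comm]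
  simp only [← Finset.sum_mul, sum_normSq_col hU, one_mul, ← Finset.sum_div]
  exact div_self hZ.ne'

/-- Nonzero entries of `U` join levels of equal total energy, so the Gibbs factors of the input can
be replaced by those of the output; the rows of `U` then sum to one. -/
theorem sum_transition_mul_exp {m : ℕ} (hm : 0 < m) (β : ℝ) (E : ι → ℝ) (B : Fin m → ℝ)
    {U : Matrix (ι × Fin m) (ι × Fin m) ℂ} (hU : U ∈ Matrix.unitaryGroup (ι × Fin m) ℂ)
    (hUH : Commute U (hamiltonian fun x : ι × Fin m => E x.1 + B x.2)) (i : ι) :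
    ∑ j, transition β B U i j * Real.exp (-β * E j) = Real.exp (-β * E i) := by
  have hZ := sum_exp_pos hm β B
  rw [commute_hamiltonian_iff] at hUH
  have h1 : ∀ s j t, Complex.normSq (U (i, s) (j, t)) *
      (Real.exp (-β * B t) / ∑ u, Real.exp (-β * B u)) * Real.exp (-β * E j) =
      Complex.normSq (U (i, s) (j, t)) *
      (Real.exp (-β * B s) / (∑ u, Real.exp (-β * B u)) * Real.exp (-β * E i)) := by
    intro s j t
    by_cases h : E i + B s = E j + B t
    · have : Real.exp (-β * B t) * Real.exp (-β * E j) =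
          Real.exp (-β * B s) * Real.exp (-β * E i) := by
        rw [← Real.exp_add, ← Real.exp_add]
        congr 1
        linear_combination (-β) * (-h)
      rw [mul_assoc, div_mul_eq_mul_div, div_mul_eq_mul_div, this]
    · rw [hUH (i, s) (j, t) h]
      simp
  calc ∑ j, transition β B U i j * Real.exp (-β * E j)
      = ∑ s, ∑ j, ∑ t, Complex.normSq (U (i, s) (j, t)) *
          (Real.exp (-β * B t) / ∑ u, Real.exp (-β * B u)) * Real.exp (-β * E j) := by
        rw [Finset.sum_comm]
        refine Finset.sum_congr rfl fun j _ => ?_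
        simp only [transition, Finset.sum_mul]
    _ = ∑ s, Real.exp (-β * B s) / (∑ u, Real.exp (-β * B u)) * Real.exp (-β * E i) := by
        refine Finset.sum_congr rfl fun s _ => ?_
        simp only [h1]
        rw [← Fintype.sum_prod_type' (f := fun j t => Complex.normSq (U (i, s) (j, t)) *
          (Real.exp (-β * B s) / (∑ u, Real.exp (-β * B u)) * Real.exp (-β * E i))),
          ← Finset.sum_mul, sum_normSq_row hU, one_mul]
    _ = Real.exp (-β * E i) := by
        rw [← Finset.sum_mul, ← Finset.sum_div, div_self hZ.ne', one_mul]

/-- The bath is diagonal, so a coherence `ρ j k` could reach a population only through bath level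
`u` on both sides. Energy conservation then forces `E j = E k`, where `ρ j k = 0`; coherences
between different energies drop out. -/
theorem traceOut_apply_self_eq_sum_transition {m : ℕ} (β : ℝ) (E : ι → ℝ) (B : Fin m → ℝ)
    {U : Matrix (ι × Fin m) (ι × Fin m) ℂ}
    (hUH : Commute U (hamiltonian fun x : ι × Fin m => E x.1 + B x.2)) {ρ : Matrix ι ι ℂ}
    (hρ : ∀ j k, j ≠ k → E j = E k → ρ j k = 0) (i : ι) :
    traceOut (U * (ρ ⊗ₖ gibbs β B) * U.conjTranspose) i i =
      ∑ j, (transition β B U i j : ℂ) * ρ j j := by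
  rw [commute_hamiltonian_iff] at hUH
  have h1 : ∀ s k t, (U * (ρ ⊗ₖ gibbs β B)) (i, s) (k, t) * U.conjTranspose (k, t) (i, s) =
      ((Complex.normSq (U (i, s) (k, t)) *
        (Real.exp (-β * B t) / ∑ u, Real.exp (-β * B u)) : ℝ) : ℂ) * ρ k k := by
    intro s k t
    rw [Matrix.mul_apply, Finset.sum_mul, Finset.sum_eq_single (k, t)]
    · rw [Matrix.kroneckerMap_apply, gibbs, Matrix.diagonal_apply_eq, Matrix.conjTranspose_apply,
        Complex.star_def, Complex.ofReal_mul, ← Complex.mul_conj]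
      ring
    · rintro ⟨j, u⟩ - hne
      rw [Matrix.kroneckerMap_apply, gibbs]
      by_cases hut : u = t
      · subst hut
        have hjk : j ≠ k := fun h => hne (by rw [h])
        by_cases hE : E j = E k
        · rw [hρ j k hjk hE]
          simp
        · by_cases hE' : E i + B s = E j + B u
          · rw [Matrix.conjTranspose_apply, hUH (i, s) (k, u)]
            · simp
            · intro h
              dsimp only at h
              exact hE (by linarith)
          · rw [hUH (i, s) (j, u) hE']
            simp
      · rw [Matrix.diagonal_apply_ne _ hut]
        simp
    · simp
  simp only [traceOut, Matrix.of_apply, Matrix.mul_apply (M := U * _), Fintype.sum_prod_type, h1,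
    transition, Complex.ofReal_sum, Finset.sum_mul]
  rw [Finset.sum_comm]

/-- `V` and `W` are absorbed into the unitary `U'`, so the populations are related by its transition
matrix. As that matrix fixes the Gibbs weights, it also maps `p - c w` to `q - c w`, and it is
stochastic; convexity of the positive part concludes. -/
theorem ThermalOperation.sum_max_le {β : ℝ} {E : ι → ℝ} {ρ σ V W : Matrix ι ι ℂ}
    (h : ThermalOperation β E ρ σ) (hV : V ∈ Matrix.unitaryGroup ι ℂ)
    (hVH : Commute V (hamiltonian E)) (hW : W ∈ Matrix.unitaryGroup ι ℂ)
    (hWH : Commute W (hamiltonian E))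
    (hρ : ∀ j k, j ≠ k → E j = E k → (V * ρ * V.conjTranspose) j k = 0) (c : ℝ) :
    ∑ i, max (((W * σ * W.conjTranspose) i i).re - c * Real.exp (-β * E i)) 0 ≤
      ∑ i, max (((V * ρ * V.conjTranspose) i i).re - c * Real.exp (-β * E i)) 0 := by
  obtain ⟨m, hm, B, U, hU, hUH, rfl⟩ := h
  set U' := (W ⊗ₖ (1 : Matrix (Fin m) (Fin m) ℂ)) * U *
    (V.conjTranspose ⊗ₖ (1 : Matrix (Fin m) (Fin m) ℂ)) with hU'
  have hU'mem : U' ∈ Matrix.unitaryGroup (ι × Fin m) ℂ :=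
    mul_mem (mul_mem (kronecker_one_mem_unitaryGroup hW) hU)
      (kronecker_one_mem_unitaryGroup (conjTranspose_mem_unitaryGroup hV))
  have hU'H : Commute U' (hamiltonian fun x : ι × Fin m => E x.1 + B x.2) :=
    ((commute_kronecker_one_hamiltonian B hWH).mul_left hUH).mul_left
      (commute_kronecker_one_hamiltonian B (commute_conjTranspose_hamiltonian hVH))
  have hVV := conjTranspose_mul_self_of_unitary hV
  have hconj : U' * ((V * ρ * V.conjTranspose) ⊗ₖ gibbs β B) * U'.conjTranspose =
      (W ⊗ₖ (1 : Matrix (Fin m) (Fin m) ℂ)) * (U * (ρ ⊗ₖ gibbs β B) * U.conjTranspose) *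
        (W.conjTranspose ⊗ₖ (1 : Matrix (Fin m) (Fin m) ℂ)) := by
    have hk : (V.conjTranspose ⊗ₖ (1 : Matrix (Fin m) (Fin m) ℂ)) *
        ((V * ρ * V.conjTranspose) ⊗ₖ gibbs β B) * (V ⊗ₖ (1 : Matrix (Fin m) (Fin m) ℂ)) =
        ρ ⊗ₖ gibbs β B := by
      rw [← Matrix.mul_kronecker_mul, ← Matrix.mul_kronecker_mul, one_mul, mul_one]
      congr 1
      calc V.conjTranspose * (V * ρ * V.conjTranspose) * V
          = (V.conjTranspose * V) * ρ * (V.conjTranspose * V) := by simp only [mul_assoc]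
        _ = ρ := by rw [hVV, one_mul, mul_one]
    rw [← hk, hU', Matrix.conjTranspose_mul, Matrix.conjTranspose_mul,
      Matrix.conjTranspose_kronecker, Matrix.conjTranspose_kronecker,
      Matrix.conjTranspose_conjTranspose, Matrix.conjTranspose_one]
    simp only [mul_assoc]
  set p : ι → ℝ := fun j => ((V * ρ * V.conjTranspose) j j).re with hp
  set w : ι → ℝ := fun j => Real.exp (-β * E j) with hw
  have hq : ∀ i, ((W * traceOut (U * (ρ ⊗ₖ gibbs β B) * U.conjTranspose) *
      W.conjTranspose) i i).re = ∑ j, transition β B U' i j * p j := by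
    intro i
    rw [← traceOut_conj_kronecker_one, ← hconj,
      traceOut_apply_self_eq_sum_transition β E B hU'H hρ, Complex.re_sum]
    exact Finset.sum_congr rfl fun j _ => Complex.re_ofReal_mul _ _
  calc ∑ i, max (((W * traceOut (U * (ρ ⊗ₖ gibbs β B) * U.conjTranspose) *
        W.conjTranspose) i i).re - c * w i) 0
      ≤ ∑ i, ∑ j, transition β B U' i j * max (p j - c * w j) 0 := by
        refine Finset.sum_le_sum fun i _ => max_le ?_ ?_
        · rw [hq, hw]
          dsimp only
          rw [← sum_transition_mul_exp hm β E B hU'mem hU'H i, Finset.mul_sum,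
            ← Finset.sum_sub_distrib]
          refine Finset.sum_le_sum fun j _ => ?_
          calc _ = transition β B U' i j * (p j - c * Real.exp (-β * E j)) := by ring
            _ ≤ _ := mul_le_mul_of_nonneg_left (le_max_left _ _) (transition_nonneg _ _ _ _ _)
        · exact Finset.sum_nonneg fun j _ =>
            mul_nonneg (transition_nonneg _ _ _ _ _) (le_max_right _ _)
    _ = ∑ j, max (p j - c * w j) 0 := by
        rw [Finset.sum_comm]
        refine Finset.sum_congr rfl fun j _ => ?_
        rw [← Finset.sum_mul, sum_transition hm β B hU'mem, one_mul]

/-- For fixed `V` and `W` the inequality is closed in `σ`. The approximating states need not be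
diagonalised by `W`, and the exact case does not ask for it. -/
theorem ThermallyConvertible.sum_max_le {β : ℝ} {E : ι → ℝ} {ρ σ V W : Matrix ι ι ℂ}
    (h : ThermallyConvertible β E ρ σ) (hV : V ∈ Matrix.unitaryGroup ι ℂ)
    (hVH : Commute V (hamiltonian E)) (hW : W ∈ Matrix.unitaryGroup ι ℂ)
    (hWH : Commute W (hamiltonian E))
    (hρ : ∀ j k, j ≠ k → E j = E k → (V * ρ * V.conjTranspose) j k = 0) (c : ℝ) :
    ∑ i, max (((W * σ * W.conjTranspose) i i).re - c * Real.exp (-β * E i)) 0 ≤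
      ∑ i, max (((V * ρ * V.conjTranspose) i i).re - c * Real.exp (-β * E i)) 0 := by
  have hclosed : IsClosed {σ : Matrix ι ι ℂ |
      ∑ i, max (((W * σ * W.conjTranspose) i i).re - c * Real.exp (-β * E i)) 0 ≤
      ∑ i, max (((V * ρ * V.conjTranspose) i i).re - c * Real.exp (-β * E i)) 0} := by
    refine isClosed_le (continuous_finsetSum _ fun i _ => ?_) continuous_const
    refine Continuous.max (Continuous.sub (Complex.continuous_re.comp ?_) continuous_const)
      continuous_const
    exact ((continuous_const.matrix_mul continuous_id).matrix_mul
      continuous_const).matrix_elem i i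
  exact hclosed.closure_subset_iff.2
    (fun σ' hσ' => ThermalOperation.sum_max_le hσ' hV hVH hW hWH hρ c) h

end Unitaries

/-! ### Complete dephasing by random energy-conserving phases -/

/-- Diagonal matrix of the `k`-th powers of distinct `n`-th roots of unity. -/
noncomputable def phaseMatrix (n : ℕ) (k : Fin n) : Matrix (Fin n) (Fin n) ℂ :=
  Matrix.diagonal fun i => (Complex.exp (2 * Real.pi * Complex.I / n) ^ (i : ℕ)) ^ (k : ℕ)

theorem star_rootOfUnity_mul_self {n : ℕ} (hn : n ≠ 0) :
    Complex.exp (2 * Real.pi * Complex.I / n) * star (Complex.exp (2 * Real.pi * Complex.I / n))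
      = 1 := by
  have h1 := (Complex.isPrimitiveRoot_exp n hn).norm'_eq_one hn
  rw [Complex.star_def, Complex.mul_conj, Complex.normSq_eq_norm_sq, h1]
  simp

theorem phaseMatrix_mem_unitaryGroup {n : ℕ} (k : Fin n) :
    phaseMatrix n k ∈ Matrix.unitaryGroup (Fin n) ℂ := by
  have hn : n ≠ 0 := by
    rintro rfl
    exact k.elim0
  rw [Matrix.mem_unitaryGroup_iff, phaseMatrix, Matrix.star_eq_conjTranspose,
    Matrix.diagonal_conjTranspose, Matrix.diagonal_mul_diagonal, ← Matrix.diagonal_one]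
  congr 1
  funext i
  rw [Pi.star_apply, star_pow, star_pow, ← mul_pow, ← mul_pow, star_rootOfUnity_mul_self hn,
    one_pow, one_pow]

theorem commute_phaseMatrix_hamiltonian {n : ℕ} (k : Fin n) (E : Fin n → ℝ) :
    Commute (phaseMatrix n k) (hamiltonian E) := by
  rw [commute_hamiltonian_iff]
  intro i j hij
  exact Matrix.diagonal_apply_ne _ fun h => hij (congrArg E h)

/-- The `(i, j)` entry is multiplied by the average of the powers of an `n`-th root of unity, which
differs from 1 when `i ≠ j`, so the geometric sum vanishes. -/
theorem sum_phaseMatrix_conj {n : ℕ} (A : Matrix (Fin n) (Fin n) ℂ) :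
    ∑ k, (((n : ℝ)⁻¹ : ℝ) : ℂ) • (phaseMatrix n k * A * (phaseMatrix n k).conjTranspose) =
      Matrix.diagonal fun i => A i i := by
  refine Matrix.ext fun i j => ?_
  have hn : n ≠ 0 := by
    rintro rfl
    exact i.elim0
  have hnC : (n : ℂ) ≠ 0 := by exact_mod_cast hn
  set ζ := Complex.exp (2 * Real.pi * Complex.I / n) with hζ
  have hprim : IsPrimitiveRoot ζ n := Complex.isPrimitiveRoot_exp n hn
  have hζs : ζ * star ζ = 1 := star_rootOfUnity_mul_self hn
  have hentry : ∀ k : Fin n, (phaseMatrix n k * A * (phaseMatrix n k).conjTranspose) i j =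
      A i j * (ζ ^ (i : ℕ) * star ζ ^ (j : ℕ)) ^ (k : ℕ) := by
    intro k
    rw [phaseMatrix, Matrix.diagonal_conjTranspose, Matrix.mul_diagonal, Matrix.diagonal_mul,
      Pi.star_apply, star_pow, star_pow, mul_pow]
    ring
  rw [Matrix.sum_apply]
  simp only [Matrix.smul_apply, hentry, smul_eq_mul]
  rw [← Finset.mul_sum, ← Finset.mul_sum, Fin.sum_univ_eq_sum_range]
  by_cases hij : i = j
  · subst hij
    rw [Matrix.diagonal_apply_eq, ← mul_pow, hζs, one_pow]
    simp
    field_simp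
  · rw [Matrix.diagonal_apply_ne _ hij]
    have hx1 : ζ ^ (i : ℕ) * star ζ ^ (j : ℕ) ≠ 1 := by
      intro h
      refine hij (Fin.ext (hprim.pow_inj i.2 j.2 ?_))
      calc ζ ^ (i : ℕ) = ζ ^ (i : ℕ) * star ζ ^ (j : ℕ) * ζ ^ (j : ℕ) := by
            rw [mul_assoc, ← mul_pow, mul_comm (star ζ), hζs, one_pow, mul_one]
        _ = ζ ^ (j : ℕ) := by rw [h, one_mul]
    have hxn : (ζ ^ (i : ℕ) * star ζ ^ (j : ℕ)) ^ n = 1 := by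
      have h1 : ζ ^ n = 1 := hprim.pow_eq_one
      have h2 : star ζ ^ n = 1 := by rw [← star_pow, h1, star_one]
      rw [mul_pow, pow_right_comm, h1, pow_right_comm, h2, one_pow, one_pow, one_mul]
    rw [geom_sum_eq hx1, hxn]
    simp

end CoarseThermo

namespace CoarseThermo

open Relation Filter Topology

namespace Config

variable {ι κ : Type} [Fintype ι] [DecidableEq ι] [Fintype κ] [DecidableEq κ]

/-! ### Sharp work records -/

theorem mapState_initial (E : ι → ℝ) (E' : κ → ℝ) {f : Matrix ι ι ℂ → Matrix κ κ ℂ}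
    (hf : f 0 = 0) (ρ : Matrix ι ι ℂ) : (initial E ρ).mapState E' f = initial E' (f ρ) := by
  unfold mapState initial
  congr 1
  exact Finsupp.sum_single_index (by rw [hf, Finsupp.single_zero])

theorem moment_initial (g : ℝ → ℝ) (E : ι → ℝ) (ρ : Matrix ι ι ℂ) (i : ι) :
    (initial E ρ).moment g i = g 0 * (ρ i i).re :=
  Finsupp.sum_single_index (by simp)

theorem expect_initial (g : ℝ → ℝ) (E : ι → ℝ) (ρ : Matrix ι ι ℂ) :
    (initial E ρ).expect g = g 0 * ρ.trace.re :=
  Finsupp.sum_single_index (by simp)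

theorem isClassical_initial (E : ι → ℝ) {ρ : Matrix ι ι ℂ} (hρ : ρ ∈ classicalMatrices ι) :
    (initial E ρ).IsClassical :=
  fun w => single_apply_mem _ hρ 0 w

/-! ### States of classical configurations -/

theorem branch_mapState_apply (E' : κ → ℝ) {f : Matrix ι ι ℂ → Matrix κ κ ℂ} (hf : f 0 = 0)
    (C : Config ι) (w : ℝ) : (C.mapState E' f).branch w = f (C.branch w) := by
  simp only [mapState, Finsupp.sum_apply, Finsupp.single_apply]
  rw [Finsupp.sum_ite_eq']
  split_ifs with h
  · rfl
  · rw [Finsupp.notMem_support_iff.1 h, hf]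

theorem IsClassical.state_eq {C : Config ι} (hC : C.IsClassical) :
    C.state = Matrix.diagonal fun i => (C.population i : ℂ) := by
  have hmem : C.state ∈ classicalMatrices ι := AddSubmonoid.sum_mem _ fun w _ => hC w
  refine Matrix.ext fun i j => ?_
  by_cases hij : i = j
  · subst hij
    rw [Matrix.diagonal_apply_eq]
    have h1 : (C.state i i).re = C.population i := by
      unfold state population moment Finsupp.sum
      rw [Matrix.sum_apply, Complex.re_sum]
      simp
    have h2 := Complex.nonneg_iff.1 (hmem.2 i)
    exact Complex.ext (by simpa using h1) (by simpa using h2.2.symm)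
  · rw [Matrix.diagonal_apply_ne _ hij]
    exact hmem.1 hij

theorem IsClassical.isNormalized {C : Config ι} (hC : C.IsClassical)
    (h1 : C.expect (fun _ => 1) = 1) : C.IsNormalized := by
  refine ⟨fun w => ?_, h1⟩
  simp only [Matrix.trace, Matrix.diag_apply, Complex.re_sum]
  exact Finset.sum_nonneg fun i _ => (Complex.nonneg_iff.1 ((hC w).2 i)).1

theorem IsNormalized.mapState {C : Config ι} (hC : C.IsNormalized) (E' : κ → ℝ)
    {f : Matrix ι ι ℂ → Matrix κ κ ℂ} (hf0 : f 0 = 0) (hf : ∀ A, (f A).trace = A.trace) :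
    (C.mapState E' f).IsNormalized := by
  refine ⟨fun w => ?_, ?_⟩
  · rw [branch_mapState_apply E' hf0, hf]
    exact hC.nonneg w
  · rw [expect_mapState]
    simp only [hf]
    exact hC.total

theorem expect_mapState_of_trace_eq (g : ℝ → ℝ) (E' : κ → ℝ) {f : Matrix ι ι ℂ → Matrix κ κ ℂ}
    (hf : ∀ A, (f A).trace = A.trace) (C : Config ι) :
    (C.mapState E' f).expect g = C.expect g := by
  rw [expect_mapState]
  simp only [hf]
  rfl

theorem IsClassical.secondMoment_levelTransform_le {C : Config ι} (hC : C.IsClassical)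
    (h1 : C.expect (fun _ => 1) = 1) (h : ι → ℝ) :
    (C.levelTransform h).secondMoment ≤ 2 * C.secondMoment + 2 * ∑ i, h i ^ 2 := by
  rw [secondMoment, secondMoment, ← sum_moment, ← sum_moment, Finset.mul_sum, Finset.mul_sum,
    ← Finset.sum_add_distrib]
  refine Finset.sum_le_sum fun i _ => ?_
  rw [moment_levelTransform]
  have hpop : C.population i ≤ 1 := by
    rw [← h1, ← sum_moment]
    exact Finset.single_le_sum (f := fun i => C.moment (fun _ => 1) i)
      (fun k _ => hC.moment_nonneg (fun _ => zero_le_one) k) (Finset.mem_univ i)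
  have hle : C.moment (fun w => (w + h i) ^ 2) i ≤
      C.moment (fun w => 2 * w ^ 2 + 2 * h i ^ 2 * 1) i :=
    hC.moment_mono (fun w => by nlinarith [sq_nonneg (w - h i)]) i
  rw [moment_add, moment_const_mul 2, moment_const_mul (2 * h i ^ 2) (fun _ => 1)] at hle
  have h2 : 2 * h i ^ 2 * C.moment (fun _ => 1) i ≤ 2 * h i ^ 2 * 1 :=
    mul_le_mul_of_nonneg_left hpop (by positivity)
  linarith

theorem energy_eq_log_weight {β : ℝ} (hβ : 0 < β) (C : Config ι) (i : ι) :
    C.energy i = -Real.log (C.weight β i) / β := by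
  rw [weight, Real.log_exp]
  field_simp

/-- If a description with positive weights is attainable, then protocols ending with a small level
transformation reach its energies exactly. -/
theorem exists_seq_of_attainable {β : ℝ} (hβ : 0 < β) {𝒰 : Set (Matrix ι ι ℂ)} {C : Config ι}
    {x E : ι → ℝ} (hs : Attainable β 𝒰 C fun i => (x i, Real.exp (-β * E i))) :
    ∃ D : ℕ → Config ι, (∀ t, ReflTransGen (CoarseStep β 𝒰) C (D t)) ∧
      (∀ t, (D t).IsClassical) ∧ (∀ t, (D t).expect (fun _ => 1) = 1) ∧
      (∀ t, (D t).energy = E) ∧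
      (∀ i, Tendsto (fun t => (D t).population i) atTop (𝓝 (x i))) ∧
      Tendsto (fun t => (D t).secondMoment) atTop (𝓝 0) := by
  obtain ⟨u, hu, hlim⟩ := mem_closure_iff_seq_limit.1 hs
  choose D hreach hcl htot hdesc hm using hu
  have hlim1 : ∀ i, Tendsto (fun t => (u t).1 i) atTop (𝓝 (x i, Real.exp (-β * E i))) :=
    fun i => (tendsto_pi_nhds.1 ((continuous_fst.tendsto _).comp hlim)) i
  have hlim2 : Tendsto (fun t => (u t).2) atTop (𝓝 0) := (continuous_snd.tendsto _).comp hlim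
  have hpop : ∀ i, Tendsto (fun t => (D t).population i) atTop (𝓝 (x i)) := by
    intro i
    have := (continuous_fst.tendsto _).comp (hlim1 i)
    refine this.congr fun t => ?_
    rw [Function.comp_apply, hdesc]
  have henergy : ∀ i, Tendsto (fun t => (D t).energy i) atTop (𝓝 (E i)) := by
    intro i
    have h1 : Tendsto (fun t => (D t).weight β i) atTop (𝓝 (Real.exp (-β * E i))) := by
      have := (continuous_snd.tendsto _).comp (hlim1 i)
      refine this.congr fun t => ?_
      rw [Function.comp_apply, hdesc]
    have h2 := ((h1.log (Real.exp_pos _).ne').neg.div_const β)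
    rw [Real.log_exp] at h2
    have h3 : -(-β * E i) / β = E i := by field_simp
    rw [h3] at h2
    exact h2.congr fun t => (energy_eq_log_weight hβ (D t) i).symm
  -- The limiting weights are positive, so the energies converge to `E` and the corrective shift,
  -- with its work, tends to zero.
  refine ⟨fun t => (D t).levelTransform fun i => E i - (D t).energy i, fun t => ?_, fun t => ?_,
    fun t => ?_, fun t => ?_, fun i => ?_, ?_⟩
  · exact (hreach t).tail (.levelTransformation _ _ (hcl t).isDiag)
  · exact (hcl t).levelTransform _
  · rw [← sum_moment]
    simp only [moment_levelTransform]
    rw [sum_moment, htot]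
  · funext i
    simp [levelTransform]
  · refine (hpop i).congr fun t => ?_
    exact (moment_levelTransform (fun _ => 1) (fun i => E i - (D t).energy i) (D t) i).symm
  · have hsq : Tendsto (fun t => 2 * (u t).2 + 2 * ∑ i, (E i - (D t).energy i) ^ 2) atTop
        (𝓝 (2 * 0 + 2 * ∑ i, (E i - E i) ^ 2)) :=
      (hlim2.const_mul 2).add ((tendsto_finsetSum _ fun i _ =>
        ((henergy i).const_sub (E i)).pow 2).const_mul 2)
    simp only [sub_self, mul_zero, ne_eq, OfNat.ofNat_ne_zero, not_false_eq_true, zero_pow,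
      Finset.sum_const_zero, add_zero] at hsq
    refine squeeze_zero (fun t => ?_) (fun t => ?_) hsq
    · rw [secondMoment, ← sum_moment]
      exact Finset.sum_nonneg fun i _ =>
        ((hcl t).levelTransform _).moment_nonneg (fun _ => sq_nonneg _) i
    · exact ((hcl t).secondMoment_levelTransform_le (htot t) _).trans (by linarith [hm t])

end Config

/-! ### Use of the thermal ancilla qubit -/

section Ancilla

variable {ι : Type} [Fintype ι] [DecidableEq ι]

theorem trace_traceOut {κ : Type} [Fintype κ] (A : Matrix (ι × κ) (ι × κ) ℂ) :
    (traceOut A).trace = A.trace := by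
  simp [Matrix.trace, traceOut, Fintype.sum_prod_type]

theorem traceOut_diagonal {κ : Type} [Fintype κ] [DecidableEq κ] (f : ι × κ → ℂ) :
    traceOut (Matrix.diagonal f) = Matrix.diagonal fun i => ∑ s, f (i, s) := by
  refine Matrix.ext fun i j => ?_
  rw [traceOut, Matrix.of_apply]
  by_cases hij : i = j
  · subst hij
    simp
  · rw [Matrix.diagonal_apply_ne _ hij]
    exact Finset.sum_eq_zero fun s _ => Matrix.diagonal_apply_ne _ (by simp [hij])

theorem map_univ_prod_fin_two {α : Type*} (f : ι → α) (z : α) :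
    (Finset.univ : Finset (ι × Fin 2)).val.map (fun x => if x.2 = 0 then f x.1 else z) =
      Finset.univ.val.map f + Multiset.replicate (Fintype.card ι) z := by
  have h : ∀ {γ : Type} [Fintype γ] (g : γ → α),
      Finset.univ.val.map g = ∑ x, ({g x} : Multiset α) := by
    intro γ _ g
    have := Multiset.sum_map_singleton (Finset.univ.val.map g)
    rw [Multiset.map_map] at this
    exact this.symm
  rw [h, h, Fintype.sum_prod_type]
  simp only [Fin.sum_univ_two, if_true, one_ne_zero, if_false, Finset.sum_add_distrib,
    Finset.sum_const, Finset.card_univ, Multiset.nsmul_singleton]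

/-- With a thermal ancilla qubit, populations can be changed along thermo-majorization. -/
theorem attainable_of_thermoMajorization {n : ℕ} (hn : 0 < n) {β : ℝ} (hβ : 0 < β)
    (E p q : Fin n → ℝ) (a : Fin 2 → ℝ) (𝒰 : Set (Matrix (Fin n × Fin 2) (Fin n × Fin 2) ℂ))
    (hp : ∀ i, 0 ≤ p i) (hp1 : ∑ i, p i = 1) (hq1 : ∑ i, q i = 1)
    (h : ∀ c, ∑ i, max (q i - c * Real.exp (-β * E i)) 0 ≤
      ∑ i, max (p i - c * Real.exp (-β * E i)) 0) :
    Attainable β 𝒰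
      ((Config.initial E (Matrix.diagonal fun i => (p i : ℂ))).appendAncilla β a)
      fun x => (q x.1 * (Real.exp (-β * a x.2) / ∑ s, Real.exp (-β * a s)),
        Real.exp (-β * (E x.1 + a x.2))) := by
  set Z : ℝ := ∑ s, Real.exp (-β * a s) with hZ
  have hZ0 : 0 < Z := sum_exp_pos two_pos β a
  have hZ2 : Z = Real.exp (-β * a 0) + Real.exp (-β * a 1) := by rw [hZ, Fin.sum_univ_two]
  set C := (Config.initial E (Matrix.diagonal fun i => (p i : ℂ))).appendAncilla β a with hC
  have hCinit : C = Config.initial (fun x : Fin n × Fin 2 => E x.1 + a x.2)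
      (Matrix.diagonal fun x : Fin n × Fin 2 => ((p x.1 * (Real.exp (-β * a x.2) / Z) : ℝ) : ℂ)) := by
    rw [hC, Config.appendAncilla, Config.mapState_initial (f := fun A => A ⊗ₖ gibbs β a) _ _ (Matrix.zero_kronecker _), gibbs,
      Matrix.diagonal_kronecker_diagonal]
    congr 2
    funext x
    rw [← Complex.ofReal_mul]
  have hstart : Attainable β 𝒰 C fun x : Fin n × Fin 2 =>
      (p x.1 * (Real.exp (-β * a x.2) / Z), Real.exp (-β * (E x.1 + a x.2))) := by
    refine subset_closure ⟨C, .refl, ?_, ?_, ?_, ?_⟩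
    · rw [hCinit]
      refine Config.isClassical_initial _ ⟨Matrix.isDiag_diagonal _, fun x => ?_⟩
      rw [Matrix.diagonal_apply_eq]
      exact_mod_cast mul_nonneg (hp _) (by positivity)
    · rw [hCinit, Config.expect_initial, Matrix.trace_diagonal, one_mul, ← Complex.ofReal_sum,
        Complex.ofReal_re, Fintype.sum_prod_type]
      simp only [← Finset.mul_sum, ← Finset.sum_div, ← hZ, div_self hZ0.ne', mul_one, hp1]
    · intro x
      rw [Config.population, hCinit, Config.moment_initial, Matrix.diagonal_apply_eq,
        Complex.ofReal_re, one_mul]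
      rfl
    · rw [Config.secondMoment, hCinit, Config.expect_initial]
      simp
  have hmerge : Attainable β 𝒰 C fun x : Fin n × Fin 2 =>
      if x.2 = 0 then (p x.1, Real.exp (-β * E x.1) * Z) else 0 := by
    convert hstart.rebalance_fibers hβ zero_le_one le_rfl using 1
    funext x
    split_ifs
    · rw [one_smul]
      ext
      · simp only [Prod.mk_add_mk]
        rw [← mul_add, ← add_div, ← hZ2, div_self hZ0.ne', mul_one]
      · simp only [Prod.mk_add_mk]
        rw [mul_add (-β), mul_add (-β), Real.exp_add, Real.exp_add, ← mul_add, ← hZ2]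
    · rw [sub_self, zero_smul]
  have hflow := Flows.of_thermoMajorization (w := fun i => Real.exp (-β * E i) * Z)
    (fun i => by positivity) p q (hp1.trans hq1.symm) (fun c => by
      -- Merging the ancilla copies scales all weights by `Z`; the factor is absorbed into the
      -- threshold.
      have := h (c * Z)
      simp only [mul_assoc, mul_comm Z] at this
      exact this)
  have htarget : Attainable β 𝒰 C fun x : Fin n × Fin 2 =>
      if x.2 = 0 then (q x.1, Real.exp (-β * E x.1) * Z) else 0 := by
    refine hmerge.of_flows hβ ?_ ⟨(⟨0, hn⟩, 1), by simp⟩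
    rw [map_univ_prod_fin_two (fun i => (p i, Real.exp (-β * E i) * Z)),
      map_univ_prod_fin_two (fun i => (q i, Real.exp (-β * E i) * Z)), Fintype.card_fin]
    exact hflow
  convert htarget.rebalance_fibers hβ (θ := Real.exp (-β * a 0) / Z) (by positivity)
    ((div_le_one hZ0).2 (by rw [hZ2]; linarith [Real.exp_pos (-β * a 1)])) using 1
  funext x
  obtain ⟨i, t⟩ := x
  have h1 : 1 - Real.exp (-β * a 0) / Z = Real.exp (-β * a 1) / Z := by
    rw [eq_div_iff hZ0.ne', sub_mul, div_mul_cancel₀ _ hZ0.ne', one_mul, hZ2]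
    ring
  rw [h1, mul_add (-β), Real.exp_add]
  fin_cases t
  · ext
    · simp [mul_comm]
    · simp
      field_simp
  · ext
    · simp [mul_comm]
    · simp
      field_simp

end Ancilla

/-! ### The complete protocol -/

/-- Energy-conserving unitaries dephase a state completely in any energy eigenbasis. -/
theorem coarseStep_dephase {n : ℕ} (hn : n ≠ 0) (β : ℝ) (E : Fin n → ℝ)
    {V : Matrix (Fin n) (Fin n) ℂ} (hV : V ∈ Matrix.unitaryGroup (Fin n) ℂ)
    (hVH : Commute V (hamiltonian E)) (ρ : Matrix (Fin n) (Fin n) ℂ) :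
    CoarseStep β Set.univ (Config.initial E ρ)
      (Config.initial E (Matrix.diagonal fun i => (V * ρ * V.conjTranspose) i i)) := by
  have hnR : (n : ℝ) ≠ 0 := by exact_mod_cast hn
  have h := CoarseStep.unitary (β := β) (𝒰 := Set.univ) (Config.initial E ρ) n
    (fun _ => (n : ℝ)⁻¹) (fun k => phaseMatrix n k * V) (fun _ => by positivity)
    (by simp [hnR]) (fun k => mul_mem (phaseMatrix_mem_unitaryGroup k) hV)
    (fun _ => Set.mem_univ _) (fun k => (commute_phaseMatrix_hamiltonian k E).mul_left hVH)
  convert h using 1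
  rw [Config.randomUnitary, Config.mapState_initial _ _ (by simp), ← sum_phaseMatrix_conj]
  congr 1
  refine Finset.sum_congr rfl fun k _ => ?_
  rw [Matrix.conjTranspose_mul]
  simp only [mul_assoc]

/-- Block-diagonality of `σ` makes `W σ W†` fully diagonal, so its populations `q` determine `σ` and
the final unitary `W†` recovers it. For `ρ` only the diagonal of `V ρ V†` is kept, by dephasing. -/
theorem freelyCoarselyConvertible_of_thermallyConvertible {n : ℕ} {β : ℝ} (hβ : 0 < β)
    {E : Fin n → ℝ} (a : Fin 2 → ℝ) {ρ σ : Matrix (Fin n) (Fin n) ℂ} (hρ : IsDensity ρ)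
    (hσ : IsDensity σ) (hσE : IsBlockDiagonal E σ) (hTO : ThermallyConvertible β E ρ σ) :
    FreelyCoarselyConvertible β a E ρ σ := by
  have hn : n ≠ 0 := by
    rintro rfl
    simpa [Matrix.trace] using hρ.2
  obtain ⟨V, hV, hVH, hVρ⟩ := exists_unitary_diagonal_on_blocks E hρ.1.isHermitian
  obtain ⟨W, hW, hWH, hWσ⟩ := exists_unitary_diagonal_on_blocks E hσ.1.isHermitian
  have hreal : ∀ {A U : Matrix (Fin n) (Fin n) ℂ}, A.PosSemidef → ∀ i,
      0 ≤ (U * A * U.conjTranspose) i i := fun hA i =>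
    (hA.mul_mul_conjTranspose_same _).diag_nonneg
  set p : Fin n → ℝ := fun i => ((V * ρ * V.conjTranspose) i i).re with hp
  set q : Fin n → ℝ := fun i => ((W * σ * W.conjTranspose) i i).re with hq
  have hpdiag : (Matrix.diagonal fun i => (V * ρ * V.conjTranspose) i i) =
      Matrix.diagonal fun i => (p i : ℂ) := by
    congr 1
    funext i
    exact Complex.eq_re_of_ofReal_le (r := 0) (by simpa using hreal hρ.1 i)
  have hqdiag : W * σ * W.conjTranspose = Matrix.diagonal fun i => (q i : ℂ) := by
    refine Matrix.ext fun i j => ?_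
    by_cases hij : i = j
    · subst hij
      rw [Matrix.diagonal_apply_eq]
      exact Complex.eq_re_of_ofReal_le (r := 0) (by simpa using hreal hσ.1 i)
    · rw [Matrix.diagonal_apply_ne _ hij]
      by_cases hE : E i = E j
      · exact hWσ i j hij hE
      · exact commute_hamiltonian_iff.1 ((hWH.mul_left (commute_hamiltonian_iff.2 hσE)).mul_left
          (commute_conjTranspose_hamiltonian hWH)) i j hE
  have hsum : ∀ {A U : Matrix (Fin n) (Fin n) ℂ}, A.trace = 1 →
      U ∈ Matrix.unitaryGroup (Fin n) ℂ → ∑ i, ((U * A * U.conjTranspose) i i).re = 1 := by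
    intro A U hA hU
    have h1 := congrArg Complex.re ((trace_unitary_conj hU A).trans hA)
    simpa [Matrix.trace, Complex.re_sum] using h1
  have hmaj := fun c => hTO.sum_max_le hV hVH hW hWH hVρ c
  obtain ⟨D, hreach, hcl, htot, henergy, hpop, hm⟩ := Config.exists_seq_of_attainable hβ
    (attainable_of_thermoMajorization (Nat.pos_of_ne_zero hn) hβ E p q a
      {V | ∃ U : Matrix (Fin n) (Fin n) ℂ, V = U ⊗ₖ 1}
      (fun i => (Complex.nonneg_iff.1 (hreal hρ.1 i)).1) (hsum hρ.2 hV) (hsum hσ.2 hW) hmaj)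
  have hWs := conjTranspose_mem_unitaryGroup hW
  let conj : Matrix (Fin n) (Fin n) ℂ →+ Matrix (Fin n) (Fin n) ℂ :=
    { toFun := fun A => W.conjTranspose * A * W
      map_zero' := by simp
      map_add' := fun A B => by rw [mul_add, add_mul] }
  have hconj_trace : ∀ A, (conj A).trace = A.trace := by
    intro A
    have := trace_unitary_conj hWs A
    rwa [Matrix.conjTranspose_conjTranspose] at this
  let out : Matrix (Fin n × Fin 2) (Fin n × Fin 2) ℂ →+ Matrix (Fin n) (Fin n) ℂ :=
    { toFun := traceOut
      map_zero' := Matrix.ext fun i j => by simp [traceOut]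
      map_add' := fun A B => Matrix.ext fun i j => by simp [traceOut, Finset.sum_add_distrib] }
  have hfinal : ∀ t, CoarseStep β Set.univ ((D t).discardAncilla E)
      (((D t).mapState E out).mapState E conj) := by
    intro t
    have h := CoarseStep.unitary (β := β) (𝒰 := Set.univ) ((D t).discardAncilla E) 1
      (fun _ => 1) (fun _ => W.conjTranspose) (fun _ => zero_le_one) (by simp) (fun _ => hWs)
      (fun _ => Set.mem_univ _) (fun _ => commute_conjTranspose_hamiltonian hWH)
    convert h using 1
    rw [Config.randomUnitary]
    congr 1
    funext A
    simp [conj]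
  have hnorm : ∀ t, (((D t).mapState E out).mapState E conj).IsNormalized := fun t =>
    (((hcl t).isNormalized (htot t)).mapState E (map_zero out) trace_traceOut).mapState E
      (map_zero conj) hconj_trace
  refine ⟨fun t => ((D t).mapState E out).mapState E conj, fun t => ⟨_, D t, E,
    .single (coarseStep_dephase hn β E hV hVH ρ), ?_, ?_, .single (hfinal t)⟩, fun _ => rfl, ?_,
    Config.tendsto_work_of_expect_sq hnorm ?_⟩
  · rw [hpdiag]
    exact hreach t
  · intro i s
    rw [henergy]
  · have hstate : ∀ t, (((D t).mapState E out).mapState E conj).state =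
        W.conjTranspose * (Matrix.diagonal fun i => ((∑ s, (D t).population (i, s) : ℝ) : ℂ)) *
          W := by
      intro t
      rw [Config.state_mapState, Config.state_mapState, (hcl t).state_eq]
      change W.conjTranspose * traceOut _ * W = _
      rw [traceOut_diagonal]
      push_cast
      rfl
    have hσ' : σ = W.conjTranspose * (Matrix.diagonal fun i => (q i : ℂ)) * W := by
      have h1 := conjTranspose_mul_self_of_unitary hW
      rw [← hqdiag]
      calc σ = (W.conjTranspose * W) * σ * (W.conjTranspose * W) := by rw [h1, one_mul, mul_one]
        _ = _ := by simp only [mul_assoc]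
    have hlim : ∀ i, Tendsto (fun t => ∑ s, (D t).population (i, s)) atTop (𝓝 (q i)) := by
      intro i
      have h1 := tendsto_finsetSum Finset.univ fun s (_ : s ∈ Finset.univ) => hpop (i, s)
      dsimp only at h1
      rwa [← Finset.mul_sum, ← Finset.sum_div, div_self (sum_exp_pos two_pos β a).ne',
        mul_one] at h1
    have hcont : Continuous fun x : Fin n → ℝ =>
        W.conjTranspose * (Matrix.diagonal fun i => (x i : ℂ)) * W := by
      refine (continuous_const.matrix_mul (Continuous.matrix_diagonal ?_)).matrix_mul
        continuous_const
      exact continuous_pi fun i => Complex.continuous_ofReal.comp (continuous_apply i)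
    rw [hσ']
    refine ((hcont.tendsto q).comp (tendsto_pi_nhds.2 hlim)).congr fun t => ?_
    rw [hstate]
    rfl
  · refine hm.congr fun t => ?_
    rw [Config.expect_mapState_of_trace_eq _ _ hconj_trace,
      Config.expect_mapState_of_trace_eq (f := out) _ _ trace_traceOut]
    rfl

end CoarseThermo

theorem mainTheorem1 {n : ℕ} (β : ℝ) (hβ : 0 < β) (E : Fin n → ℝ) (a : Fin 2 → ℝ)
    (ρ σ : Matrix (Fin n) (Fin n) ℂ)
    (hρ : CoarseThermo.IsDensity ρ) (hσ : CoarseThermo.IsDensity σ)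
    (hσE : CoarseThermo.IsBlockDiagonal E σ)
    (hTO : CoarseThermo.ThermallyConvertible β E ρ σ) :
    CoarseThermo.FreelyCoarselyConvertible β a E ρ σ :=
  CoarseThermo.freelyCoarselyConvertible_of_thermallyConvertible hβ a hρ hσ hσE hTO
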